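/- Let $\mathbb S^n$ be the space of real symmetric $n\times n$ matrices with the trace inner product $\langle A,B\rangle=\operatorname{tr}(AB)$. For an increasing sequence $i=(i_1<\dots<i_k)$ in $[d]=\{1,\dots,d\}$ let $\operatorname{Trn}_i:\mathbb S^d\to\mathbb S^k$, $Z\mapsto (z_{i_pi_q})_{p,q}$, be the truncation to the principal submatrix indexed by $i$, and let $\operatorname{Aug}_i:\mathbb S^k\to\mathbb S^d$ be the lift that puts $x_{pq}$ in position $(i_p,i_q)$ and $0$ in all other positions. A cone is proper if it is convex, closed, solid and pointed; the dual of a cone $C$ is $C^*=\{Y:\langle X,Y\rangle\ge 0 \text{ for all } X\in C\}$. Let $k_0\ge 1$, let $K^k\subseteq\mathbb S^k$ ($k\ge k_0$) be proper cones, and for $d\ge k$ let $I(d,k)$ be a set of increasing sequences of length $k$ in $[d]$. Assume the embedding property: for all $d\ge k\ge k_0$ and $i\in I(d,k)$, $\operatorname{Trn}_i(K^d)\subseteq K^k$ and $\operatorname{Aug}_i(K^k)\subseteq K^d$. The $k$th order cone is $$K^d_k=\Bigl\{\sum_{i\in I(d,k)}\operatorname{Aug}_i(M_i): M_i\in K^k\Bigr\}\subseteq\mathbb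 S^d .$$ For a convex cone $C$ in a finite-dimensional real inner product space and $\theta\in\mathbb R$, a $\theta$-logarithmically homogeneous self-concordant barrier of $C$ is a real function $h$ on $\operatorname{int} C$ such that: (a) $h$, extended by $+\infty$ to $C\setminus\operatorname{int}C$, is continuous as a function $C\to\mathbb R\cup\{+\infty\}$; (b) $h$ is convex and three times continuously differentiable on $\operatorname{int}C$, and $|\varphi'''(0)|\le 2|\varphi''(0)|^{3/2}$ for $\varphi(\alpha)=h(x+\alpha v)$, for every $x\in\operatorname{int}C$ and every vector $v$; (c) $h(tx)=h(x)-\theta\log t$ for all $x\in\operatorname{int}C$ and $t>0$. **Theorem.** Let $d\ge k\ge k_0$, let $g$ be a $\theta$-logarithmically homogeneous self-concordant barrier of $(K^k)^*$, and put $$f(Y)=\sum_{i\in I(d,k)} g(\operatorname{Trn}_i(Y)),\qquad Y\in\operatorname{int}\bigl((K^d_k)^*\bigr).$$ Then $f$ is a $\theta\,|I(d,k)|$-logarithmically homogeneous self-concordant barrier of $(K^d_k)^*$. Suppose moreover that $(K^d_k)^*$ is a proper cone and that the gradient map $\nabla f$ (with respect to the trace inner product) is injective on $\operatorname{int}((K^d_k)^*)$.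 Then $\nabla f$ is a bijection from $\operatorname{int}((K^d_k)^*)$ onto $-\operatorname{int}(K^d_k)$, and the function $$F(X)=-\operatorname{tr}\bigl(X(\nabla f)^{-1}(-X)\bigr)-f\bigl((\nabla f)^{-1}(-X)\bigr),\qquad X\in\operatorname{int}(K^d_k),$$ equals $f^*(-X)=\sup_{Y\in\operatorname{int}((K^d_k)^*)}\bigl(\langle -X,Y\rangle-f(Y)\bigr)$ and is a $\theta\,|I(d,k)|$-logarithmically homogeneous self-concordant barrier of $K^d_k$. -/

import Mathlib

noncomputable section

namespace HigherOrderCone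

/-! ### Real symmetric matrices with the trace inner product -/

/-- The real vector space of real symmetric `d × d` matrices. -/
def SymMat (d : ℕ) : Type :=
  selfAdjoint.submodule ℝ (Matrix (Fin d) (Fin d) ℝ)

namespace SymMat

variable {d k : ℕ}

instance : AddCommGroup (SymMat d) :=
  inferInstanceAs (AddCommGroup (selfAdjoint.submodule ℝ (Matrix (Fin d) (Fin d) ℝ)))

instance : Module ℝ (SymMat d) :=
  inferInstanceAs (Module ℝ (selfAdjoint.submodule ℝ (Matrix (Fin d) (Fin d) ℝ)))

/-- The inclusion of symmetric matrices into all matrices. -/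
def toMat : SymMat d →ₗ[ℝ] Matrix (Fin d) (Fin d) ℝ :=
  (selfAdjoint.submodule ℝ (Matrix (Fin d) (Fin d) ℝ)).subtype

theorem isSymm (A : SymMat d) : (toMat A).IsSymm := by
  have h : star (toMat A) = toMat A := A.2
  rwa [Matrix.star_eq_conjTranspose, Matrix.conjTranspose_eq_transpose_of_trivial] at h

theorem toMat_injective : Function.Injective (toMat (d := d)) :=
  Subtype.val_injective

/-- A symmetric matrix, as an element of `SymMat d`. -/
def mk (A : Matrix (Fin d) (Fin d) ℝ) (h : A.IsSymm) : SymMat d :=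
  ⟨A, by
    change star A = A
    rw [Matrix.star_eq_conjTranspose, Matrix.conjTranspose_eq_transpose_of_trivial]
    exact h⟩

@[simp] theorem toMat_mk (A : Matrix (Fin d) (Fin d) ℝ) (h : A.IsSymm) : toMat (mk A h) = A :=
  rfl

theorem trace_mul_self (A : SymMat d) :
    (toMat A * toMat A).trace = ∑ p, ∑ q, toMat A p q ^ 2 := by
  simp only [Matrix.trace, Matrix.diag, Matrix.mul_apply]
  refine Finset.sum_congr rfl fun p _ => Finset.sum_congr rfl fun q _ => ?_
  rw [(isSymm A).apply p q, sq]

/-- The trace inner product `⟨A, B⟩ = tr (A B)`. -/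
@[reducible] def innerCore : InnerProductSpace.Core ℝ (SymMat d) where
  inner A B := (toMat A * toMat B).trace
  conj_inner_symm A B := by
    simp only [conj_trivial]
    exact Matrix.trace_mul_comm _ _
  re_inner_nonneg A := by
    simp only [RCLike.re_to_real]
    rw [trace_mul_self]
    positivity
  add_left A B C := by
    simp [Matrix.add_mul]
  smul_left A B r := by
    simp
  definite A h := by
    rw [trace_mul_self] at h
    apply toMat_injective
    ext p q
    have h1 := (Finset.sum_eq_zero_iff_of_nonneg
      (fun p _ => Finset.sum_nonneg fun q _ => sq_nonneg (toMat A p q))).1 h p (Finset.mem_univ p)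
    have h2 := (Finset.sum_eq_zero_iff_of_nonneg
      (fun q _ => sq_nonneg (toMat A p q))).1 h1 q (Finset.mem_univ q)
    simpa using h2

instance : NormedAddCommGroup (SymMat d) :=
  (innerCore (d := d)).toNormedAddCommGroup

instance : InnerProductSpace ℝ (SymMat d) :=
  InnerProductSpace.ofCore (innerCore (d := d)).toCore

theorem inner_def (A B : SymMat d) : inner ℝ A B = (toMat A * toMat B).trace := rfl

instance : FiniteDimensional ℝ (SymMat d) :=
  FiniteDimensional.of_injective (toMat (d := d)) toMat_injective

instance : CompleteSpace (SymMat d) := FiniteDimensional.complete ℝ (SymMat d)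

/-! ### Truncation and lifting

An increasing sequence `1 ≤ i₁ < ⋯ < iₖ ≤ d` is an order embedding `Fin k ↪o Fin d`. -/

/-- The truncation operator: the principal submatrix with rows and columns `i₁, …, iₖ`. -/
def trn (i : Fin k ↪o Fin d) : SymMat d →ₗ[ℝ] SymMat k where
  toFun Z := mk ((toMat Z).submatrix i i) ((isSymm Z).submatrix i)
  map_add' Y Z := by
    apply toMat_injective
    ext p q
    simp
  map_smul' c Z := by
    apply toMat_injective
    ext p q
    simp

/-- The entries of the lift of a `k × k` matrix: `x_{pq}` in position `(i_p, i_q)`,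
and `0` elsewhere. -/
def liftMat (i : Fin k ↪o Fin d) (X : Matrix (Fin k) (Fin k) ℝ) : Matrix (Fin d) (Fin d) ℝ :=
  Matrix.of fun a b => ∑ p, ∑ q, if i p = a ∧ i q = b then X p q else 0

/-- The lift operator, embedding a `k × k` matrix as a principal submatrix of a `d × d` one. -/
def lift (i : Fin k ↪o Fin d) : SymMat k →ₗ[ℝ] SymMat d where
  toFun X := mk (liftMat i (toMat X)) (by
    ext a b
    simp only [liftMat, Matrix.transpose_apply, Matrix.of_apply]
    rw [Finset.sum_comm]
    refine Finset.sum_congr rfl fun p _ => Finset.sum_congr rfl fun q _ => ?_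
    rw [(isSymm X).apply p q]
    simp only [and_comm])
  map_add' X Y := by
    apply toMat_injective
    ext a b
    simp only [toMat_mk, map_add, liftMat, Matrix.of_apply, Matrix.add_apply,
      ← Finset.sum_add_distrib]
    refine Finset.sum_congr rfl fun p _ => Finset.sum_congr rfl fun q _ => ?_
    split_ifs <;> simp
  map_smul' c X := by
    apply toMat_injective
    ext a b
    simp [liftMat, Finset.mul_sum]

/-- Truncation is a left inverse of lifting. -/
theorem trn_lift (i : Fin k ↪o Fin d) (X : SymMat k) : trn i (lift i X) = X := by
  apply toMat_injective
  ext p q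
  simp [trn, lift, liftMat, ite_and]

end SymMat

open SymMat

/-! ### Cones -/

/-- A proper cone: a closed convex cone which is solid and pointed. -/
structure IsProperCone {E : Type*} [NormedAddCommGroup E] [InnerProductSpace ℝ E]
    (C : Set E) : Prop where
  zero_mem : (0 : E) ∈ C
  add_mem : ∀ x ∈ C, ∀ y ∈ C, x + y ∈ C
  smul_mem : ∀ t : ℝ, 0 ≤ t → ∀ x ∈ C, t • x ∈ C
  isClosed : IsClosed C
  solid : (interior C).Nonempty
  pointed : ∀ x ∈ C, -x ∈ C → x = 0

/-- The sequence of cones `K k ⊆ SymMat k`, `k ≥ k₀`, consists of proper cones and satisfies the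
embedding property with index map `I`. -/
structure EmbeddingProperty (k₀ : ℕ) (K : (k : ℕ) → Set (SymMat k))
    (I : (d k : ℕ) → Finset (Fin k ↪o Fin d)) : Prop where
  proper : ∀ k, k₀ ≤ k → IsProperCone (K k)
  trn_mem : ∀ d k, k₀ ≤ k → k ≤ d → ∀ i ∈ I d k, ∀ Z ∈ K d, trn i Z ∈ K k
  lift_mem : ∀ d k, k₀ ≤ k → k ≤ d → ∀ i ∈ I d k, ∀ X ∈ K k, lift i X ∈ K d

/-- The `k`-th order cone in `SymMat d` with index set `J` induced by the cone `C ⊆ SymMat k`. -/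
def orderCone {d k : ℕ} (C : Set (SymMat k)) (J : Finset (Fin k ↪o Fin d)) : Set (SymMat d) :=
  {M | ∃ N : (Fin k ↪o Fin d) → SymMat k, (∀ i ∈ J, N i ∈ C) ∧ M = ∑ i ∈ J, lift i (N i)}

/-- The dual cone with respect to the inner product. -/
def dualCone {E : Type*} [NormedAddCommGroup E] [InnerProductSpace ℝ E] (C : Set E) : Set E :=
  {y | ∀ x ∈ C, 0 ≤ inner ℝ x y}

/-! ### Barriers

The data of an extended-real-valued barrier is a real-valued function on the interior of the cone:
outside the interior its value is `+∞`. Thus only the values of `f` on `interior C` matter. -/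

section Barrier

variable {E : Type*} [NormedAddCommGroup E] [InnerProductSpace ℝ E]

open Classical in
/-- The extension of `f` by `+∞` outside of the interior of `C`. -/
def extendByTop (C : Set E) (f : E → ℝ) : E → EReal :=
  fun x => if x ∈ interior C then (f x : EReal) else ⊤

/-- `f`, finite on the interior of `C` and `+∞` on the boundary, is continuous on `C` as an
extended-real-valued function. -/
def IsBarrier (C : Set E) (f : E → ℝ) : Prop :=
  ContinuousOn (extendByTop C f) C

/-- Self-concordance: `f` is convex and three times continuously differentiable on the interior of
`C`, and `φ α = f (x + α h)` satisfies `|φ''' 0| ≤ 2 |φ'' 0| ^ (3 / 2)`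
for all interior points `x` and all directions `h`. -/
structure IsSelfConcordant (C : Set E) (f : E → ℝ) : Prop where
  convexOn : ConvexOn ℝ (interior C) f
  contDiffOn : ContDiffOn ℝ 3 f (interior C)
  bound : ∀ x ∈ interior C, ∀ h : E,
    |iteratedDeriv 3 (fun α : ℝ => f (x + α • h)) 0| ≤
      2 * |iteratedDeriv 2 (fun α : ℝ => f (x + α • h)) 0| ^ (3 / 2 : ℝ)

/-- Logarithmic homogeneity of degree `θ`. -/
def IsLogHomogeneous (C : Set E) (f : E → ℝ) (θ : ℝ) : Prop :=
  ∀ x ∈ interior C, ∀ t : ℝ, 0 < t → f (t • x) = f x - θ * Real.log t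

/-- A `θ`-logarithmically homogeneous self-concordant barrier of the cone `C`. -/
structure IsLogHomSelfConcordantBarrier (C : Set E) (f : E → ℝ) (θ : ℝ) : Prop where
  barrier : IsBarrier C f
  selfConcordant : IsSelfConcordant C f
  logHomogeneous : IsLogHomogeneous C f θ

end Barrier

/-- The function `f (Y) = ∑ g (Trn_i Y)`, the sum being over the index set `J`. -/
def sumBarrier {d k : ℕ} (J : Finset (Fin k ↪o Fin d)) (g : SymMat k → ℝ) : SymMat d → ℝ :=
  fun Y => ∑ i ∈ J, g (trn i Y)

/-- The inverse `(∇f)⁻¹` of the gradient of `f` (for the trace inner product) on the interior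
of `C`. -/
def gradInv {d : ℕ} (C : Set (SymMat d)) (f : SymMat d → ℝ) : SymMat d → SymMat d :=
  Function.invFunOn (gradient f) (interior C)

/-- The function `F (X) = - tr (X (∇f)⁻¹ (-X)) - f ((∇f)⁻¹ (-X))`. -/
def conjBarrier {d : ℕ} (C : Set (SymMat d)) (f : SymMat d → ℝ) : SymMat d → ℝ :=
  fun X => -(toMat X * toMat (gradInv C f (-X))).trace - f (gradInv C f (-X))

end HigherOrderCone

end

/-!
# Barriers of cones of higher order

Truncation is adjoint to lifting (`inner_lift`), so `Y` belongs to the dual of the cone of higher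
order if and only if all its truncations belong to the dual of the original cone
(`mem_dualCone_orderCone`). As truncations are surjective, the same description holds for the
interiors. Hence `f` is a sum of barriers composed with surjective linear maps, and such sums are
barriers (`IsLogHomSelfConcordantBarrier.sum_comp`).

The second half is Legendre duality for a barrier `f` with injective gradient of a proper cone `C`
in a finite-dimensional inner product space. If the Hessian of `f` degenerates in some direction,
then by self-concordance and Grönwall's inequality the gradient is constant on a segment in that
direction. Injectivity of the gradient therefore makes the Hessian positive definite
(`IsSelfConcordant.inner_hessian_pos`). Consequently the gradient is an open map, and logarithmic
homogeneity puts its image in the negative of the dual cone. It attains each `-X` with `X` interior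
to the dual cone, since `Y ↦ f Y + ⟨X, Y⟩` is coercive and has a minimizer
(`IsLogHomSelfConcordantBarrier.exists_gradient_eq`).

By convexity the minimizer realizes the supremum defining the conjugate `F (X) = f^* (-X)`. The
gradient of `F` is `-(∇f)⁻¹ (-X)`, which is `C^2` by the inverse function theorem, and
differentiating `∇²f (p X) (p' X h) = -h`, where `p X = (∇f)⁻¹ (-X)`, expresses the second and
third derivatives of `F` by those of `f` (`abs_third_legendreDual_le`). The function `F` tends to
`+∞` at a boundary point `X` of the dual cone because some nonzero `y` in `C` is orthogonal to `X`,
and `f` decreases at least logarithmically in the direction `y` (`exists_lt_inner_sub`).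

Finally, the dual of the dual of a convex cone is its closure, which has the same interior
(`interior_dualCone_dualCone`). This transfers the result to the cone of higher order itself,
whether or not it is closed.
-/

namespace HigherOrderCone

open Filter Topology Set

/-! ### Derivatives along lines -/

theorem iteratedDeriv_two_eq_of_hasDerivAt {φ φ₁ : ℝ → ℝ} {b : ℝ}
    (h₀ : ∀ᶠ t in 𝓝 0, HasDerivAt φ (φ₁ t) t) (h₁ : HasDerivAt φ₁ b 0) :
    iteratedDeriv 2 φ 0 = b := by
  have h : deriv φ =ᶠ[𝓝 0] φ₁ := h₀.mono fun t ht => ht.deriv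
  rw [iteratedDeriv_succ, iteratedDeriv_one, h.deriv_eq, h₁.deriv]

theorem iteratedDeriv_three_eq_of_hasDerivAt {φ φ₁ φ₂ : ℝ → ℝ} {c : ℝ}
    (h₀ : ∀ᶠ t in 𝓝 0, HasDerivAt φ (φ₁ t) t) (h₁ : ∀ᶠ t in 𝓝 0, HasDerivAt φ₁ (φ₂ t) t)
    (h₂ : HasDerivAt φ₂ c 0) : iteratedDeriv 3 φ 0 = c := by
  have h : deriv φ =ᶠ[𝓝 0] φ₁ := h₀.mono fun t ht => ht.deriv
  have h' : deriv φ₁ =ᶠ[𝓝 0] φ₂ := h₁.mono fun t ht => ht.deriv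
  rw [iteratedDeriv_succ, iteratedDeriv_succ, iteratedDeriv_one]
  have : deriv (deriv φ) =ᶠ[𝓝 0] φ₂ := h.deriv.trans h'
  rw [this.deriv_eq, h₂.deriv]

section Line

variable {E : Type*} [NormedAddCommGroup E] [InnerProductSpace ℝ E]

theorem hasDerivAt_line (x h : E) (t : ℝ) : HasDerivAt (fun s : ℝ => x + s • h) h t := by
  simpa using ((hasDerivAt_id t).smul_const h).const_add x

theorem eventually_line_mem {U : Set E} (hU : IsOpen U) {x h : E} {t : ℝ} (hx : x + t • h ∈ U) :
    ∀ᶠ s in 𝓝 t, x + s • h ∈ U :=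
  (hasDerivAt_line x h t).continuousAt.preimage_mem_nhds (hU.mem_nhds hx)

theorem eventually_line_mem_zero {U : Set E} (hU : IsOpen U) {x : E} (h : E) (hx : x ∈ U) :
    ∀ᶠ s in 𝓝 (0 : ℝ), x + s • h ∈ U :=
  eventually_line_mem hU (by simpa using hx)

theorem hasFDerivAt_of_contDiffOn {U : Set E} {f : E → ℝ} (hU : IsOpen U)
    (hf : ContDiffOn ℝ 3 f U) {x : E} (hx : x ∈ U) :
    HasFDerivAt f (fderiv ℝ f x) x :=
  ((hf.contDiffAt (hU.mem_nhds hx)).differentiableAt (by norm_num)).hasFDerivAt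

section Gradient

variable [CompleteSpace E] {U : Set E} {f : E → ℝ}

theorem inner_gradient_eq_fderiv (f : E → ℝ) (x h : E) :
    inner ℝ (gradient f x) h = fderiv ℝ f x h := by
  rw [← toDual_gradient, InnerProductSpace.toDual_apply_apply]

theorem gradient_eq_toDual_symm_comp (f : E → ℝ) :
    gradient f = (InnerProductSpace.toDual ℝ E).symm ∘ fderiv ℝ f := rfl

theorem contDiffOn_gradient (hU : IsOpen U) (hf : ContDiffOn ℝ 3 f U) :
    ContDiffOn ℝ 2 (gradient f) U := by
  rw [gradient_eq_toDual_symm_comp]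
  exact (InnerProductSpace.toDual ℝ E).symm.toContinuousLinearEquiv.contDiff.comp_contDiffOn
    (hf.fderiv_of_isOpen hU (by norm_num))

/-- The Hessian of `f` at `x`, as the derivative of the gradient. -/
noncomputable def hessian (f : E → ℝ) (x : E) : E →L[ℝ] E := fderiv ℝ (gradient f) x

theorem contDiffOn_hessian (hU : IsOpen U) (hf : ContDiffOn ℝ 3 f U) :
    ContDiffOn ℝ 1 (hessian f) U :=
  (contDiffOn_gradient hU hf).fderiv_of_isOpen hU (by norm_num)

theorem hasFDerivAt_gradient (hU : IsOpen U) (hf : ContDiffOn ℝ 3 f U) {x : E} (hx : x ∈ U) :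
    HasFDerivAt (gradient f) (hessian f x) x :=
  (((contDiffOn_gradient hU hf).contDiffAt (hU.mem_nhds hx)).differentiableAt
    (by norm_num)).hasFDerivAt

theorem hasFDerivAt_hessian (hU : IsOpen U) (hf : ContDiffOn ℝ 3 f U) {x : E} (hx : x ∈ U) :
    HasFDerivAt (hessian f) (fderiv ℝ (hessian f) x) x :=
  (((contDiffOn_hessian hU hf).contDiffAt (hU.mem_nhds hx)).differentiableAt
    (by norm_num)).hasFDerivAt

theorem hasDerivAt_comp_line (hU : IsOpen U) (hf : ContDiffOn ℝ 3 f U) {x h : E} {t : ℝ}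
    (hx : x + t • h ∈ U) :
    HasDerivAt (fun s : ℝ => f (x + s • h)) (inner ℝ (gradient f (x + t • h)) h) t := by
  rw [inner_gradient_eq_fderiv]
  exact (hasFDerivAt_of_contDiffOn hU hf hx).comp_hasDerivAt t (hasDerivAt_line x h t)

theorem hasDerivAt_gradient_line (hU : IsOpen U) (hf : ContDiffOn ℝ 3 f U) {x h : E} {t : ℝ}
    (hx : x + t • h ∈ U) :
    HasDerivAt (fun s : ℝ => gradient f (x + s • h)) (hessian f (x + t • h) h) t :=
  HasFDerivAt.comp_hasDerivAt (f := fun s : ℝ => x + s • h) t (hasFDerivAt_gradient hU hf hx)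
    (hasDerivAt_line x h t)

theorem hasDerivAt_inner_gradient_line (hU : IsOpen U) (hf : ContDiffOn ℝ 3 f U) {x h : E} {t : ℝ}
    (hx : x + t • h ∈ U) :
    HasDerivAt (fun s : ℝ => inner ℝ (gradient f (x + s • h)) h)
      (inner ℝ (hessian f (x + t • h) h) h) t := by
  simpa using (hasDerivAt_gradient_line hU hf hx).inner ℝ (hasDerivAt_const t h)

theorem hasDerivAt_inner_hessian_line (hU : IsOpen U) (hf : ContDiffOn ℝ 3 f U) {x h : E} {t : ℝ}
    (hx : x + t • h ∈ U) :
    HasDerivAt (fun s : ℝ => inner ℝ (hessian f (x + s • h) h) h)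
      (inner ℝ (fderiv ℝ (hessian f) (x + t • h) h h) h) t := by
  have h1 := (hasFDerivAt_hessian hU hf hx).comp_hasDerivAt t (hasDerivAt_line x h t)
  simpa using (h1.clm_apply (hasDerivAt_const t h)).inner ℝ (hasDerivAt_const t h)

theorem iteratedDeriv_two_line (hU : IsOpen U) (hf : ContDiffOn ℝ 3 f U) {x : E} (hx : x ∈ U)
    (h : E) :
    iteratedDeriv 2 (fun s : ℝ => f (x + s • h)) 0 = inner ℝ (hessian f x h) h := by
  refine iteratedDeriv_two_eq_of_hasDerivAt
    ((eventually_line_mem_zero hU h hx).mono fun t ht => hasDerivAt_comp_line hU hf ht) ?_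
  simpa using hasDerivAt_inner_gradient_line hU hf (x := x) (h := h) (t := 0) (by simpa using hx)

theorem iteratedDeriv_three_line (hU : IsOpen U) (hf : ContDiffOn ℝ 3 f U) {x : E} (hx : x ∈ U)
    (h : E) :
    iteratedDeriv 3 (fun s : ℝ => f (x + s • h)) 0 =
      inner ℝ (fderiv ℝ (hessian f) x h h) h := by
  refine iteratedDeriv_three_eq_of_hasDerivAt
    ((eventually_line_mem_zero hU h hx).mono fun t ht => hasDerivAt_comp_line hU hf ht)
    ((eventually_line_mem_zero hU h hx).mono fun t ht =>
      hasDerivAt_inner_gradient_line hU hf ht) ?_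
  simpa using hasDerivAt_inner_hessian_line hU hf (x := x) (h := h) (t := 0) (by simpa using hx)

theorem inner_hessian_symm (hU : IsOpen U) (hf : ContDiffOn ℝ 3 f U) {x : E} (hx : x ∈ U)
    (v w : E) : inner ℝ (hessian f x v) w = inner ℝ (hessian f x w) v := by
  have h2 : HasFDerivAt (fderiv ℝ f)
      ((InnerProductSpace.toDual ℝ E).toContinuousLinearEquiv.toContinuousLinearMap ∘L
        hessian f x) x := by
    rw [← toDual_comp_gradient]
    exact (InnerProductSpace.toDual ℝ E).toContinuousLinearEquiv.hasFDerivAt.comp x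
      (hasFDerivAt_gradient hU hf hx)
  have := second_derivative_symmetric_of_eventually (𝕜 := ℝ)
    ((hU.eventually_mem hx).mono fun y hy => hasFDerivAt_of_contDiffOn hU hf hy) h2 v w
  simpa using this

/-! ### Convexity and the gradient -/

/-- The graph of a convex function lies above its tangent hyperplanes. -/
theorem add_inner_gradient_le (hU : IsOpen U) (hf : ContDiffOn ℝ 3 f U) (hc : ConvexOn ℝ U f)
    {x y : E} (hx : x ∈ U) (hy : y ∈ U) : f x + inner ℝ (gradient f x) (y - x) ≤ f y := by
  have hline : (AffineMap.lineMap x y : ℝ →ᵃ[ℝ] E) ⁻¹' U = {t : ℝ | x + t • (y - x) ∈ U} := by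
    ext t
    simp [AffineMap.lineMap_apply, add_comm]
  have h1 := hc.comp_affineMap (AffineMap.lineMap x y : ℝ →ᵃ[ℝ] E)
  have h2 : f ∘ (AffineMap.lineMap x y : ℝ →ᵃ[ℝ] E) = fun t : ℝ => f (x + t • (y - x)) := by
    ext t
    simp [AffineMap.lineMap_apply, add_comm]
  rw [hline, h2] at h1
  have h3 := h1.le_slope_of_hasDerivAt (x := 0) (y := 1) (by simpa using hx) (by simpa using hy)
    one_pos (hasDerivAt_comp_line hU hf (t := 0) (by simpa using hx))
  simp only [zero_smul, add_zero, one_smul, add_sub_cancel, slope_def_field, sub_zero,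
    div_one] at h3
  linarith

theorem inner_hessian_nonneg (hU : IsOpen U) (hf : ContDiffOn ℝ 3 f U) (hc : ConvexOn ℝ U f)
    {x : E} (hx : x ∈ U) (h : E) : 0 ≤ inner ℝ (hessian f x h) h := by
  have hd := hasDerivAt_inner_gradient_line hU hf (x := x) (h := h) (t := 0) (by simpa using hx)
  simp only [zero_smul, add_zero] at hd
  have h1 := hd.tendsto_slope_zero_right
  refine ge_of_tendsto h1 ?_
  filter_upwards [(eventually_line_mem_zero hU h hx).filter_mono nhdsWithin_le_nhds,
    self_mem_nhdsWithin] with t ht ht0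
  have h2 := add_inner_gradient_le hU hf hc hx ht
  have h3 := add_inner_gradient_le hU hf hc ht hx
  have ht0 : 0 < t := ht0
  simp only [add_sub_cancel_left, sub_add_cancel_left, inner_neg_right, inner_smul_right] at h2 h3
  simp only [zero_add, zero_smul, add_zero, smul_eq_mul]
  have : 0 ≤ t * (inner ℝ (gradient f (x + t • h)) h - inner ℝ (gradient f x) h) := by linarith
  have h4 := nonneg_of_mul_nonneg_right this ht0
  positivity

end Gradient

end Line

/-! ### Self-concordance in one variable -/

theorem rpow_three_halves {x : ℝ} (hx : 0 ≤ x) : x ^ (3 / 2 : ℝ) = x * √x := by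
  rw [Real.sqrt_eq_rpow, show (3 / 2 : ℝ) = 1 + 1 / 2 by norm_num,
    Real.rpow_add' hx (by norm_num), Real.rpow_one]

/-- Grönwall's inequality for `|ψ'| ≤ 2 |ψ| ^ (3 / 2)`: the right-hand side is at most a multiple of
`|ψ|` on a compact interval. -/
theorem eq_zero_of_abs_deriv_le_rpow {ψ ψ' : ℝ → ℝ} {δ : ℝ}
    (hd : ∀ t ∈ Icc 0 δ, HasDerivAt ψ (ψ' t) t)
    (hb : ∀ t ∈ Icc 0 δ, |ψ' t| ≤ 2 * |ψ t| ^ (3 / 2 : ℝ)) (h0 : ψ 0 = 0) :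
    ∀ t ∈ Icc 0 δ, ψ t = 0 := by
  have hcont : ContinuousOn ψ (Icc 0 δ) := fun t ht => (hd t ht).continuousAt.continuousWithinAt
  obtain ⟨M, hM⟩ := isCompact_Icc.exists_bound_of_continuousOn hcont
  intro t ht
  have h := norm_le_gronwallBound_of_norm_deriv_right_le (f := ψ) (f' := ψ') (δ := 0)
    (K := 2 * √M) (ε := 0) hcont
    (fun x hx => (hd x (Ico_subset_Icc_self hx)).hasDerivWithinAt) (by simp [h0])
    (fun x hx => by
      have hx := Ico_subset_Icc_self hx
      have h1 := hb x hx
      rw [rpow_three_halves (abs_nonneg _)] at h1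
      have h2 : √|ψ x| ≤ √M := Real.sqrt_le_sqrt (hM x hx)
      rw [Real.norm_eq_abs, Real.norm_eq_abs]
      nlinarith [mul_le_mul_of_nonneg_left h2 (abs_nonneg (ψ x))]) t ht
  have h3 : ‖ψ t‖ ≤ 0 := by simpa [gronwallBound_ε0_δ0] using h
  exact norm_le_zero_iff.1 h3

/-- A nonincreasing self-concordant function `φ` on `[0, ∞)` with `φ'' > 0` tends to `-∞`, at least
as fast as minus a logarithm: self-concordance gives `φ'' ≥ (c + t) ^ (-2)` with
`c = φ'' 0 ^ (-1 / 2)`. Integrating from `t` to `∞`, where `φ' ≤ 0`, gives `φ' ≤ -(c + t)⁻¹`. -/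
theorem exists_le_sub_log_of_selfConcordant {φ φ₁ φ₂ φ₃ : ℝ → ℝ}
    (h₁ : ∀ t, 0 ≤ t → HasDerivAt φ (φ₁ t) t) (h₂ : ∀ t, 0 ≤ t → HasDerivAt φ₁ (φ₂ t) t)
    (h₃ : ∀ t, 0 ≤ t → HasDerivAt φ₂ (φ₃ t) t) (hpos : ∀ t, 0 ≤ t → 0 < φ₂ t)
    (hb : ∀ t, 0 ≤ t → |φ₃ t| ≤ 2 * |φ₂ t| ^ (3 / 2 : ℝ)) (hneg : ∀ t, 0 ≤ t → φ₁ t ≤ 0) :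
    ∃ c > 0, ∀ t, 0 ≤ t → φ t ≤ φ 0 + Real.log c - Real.log (c + t) := by
  have hint : ∀ t ∈ interior (Ici (0 : ℝ)), 0 ≤ t := fun t ht => interior_subset ht
  -- `(φ'') ^ (-1/2)` grows with slope at most `1`
  have hu : ∀ t, 0 ≤ t → HasDerivAt (fun t => (√(φ₂ t))⁻¹ - t)
      (-(φ₃ t / (2 * √(φ₂ t))) / (√(φ₂ t)) ^ 2 - 1) t := fun t ht =>
    (((h₃ t ht).sqrt (hpos t ht).ne').fun_inv (Real.sqrt_pos.2 (hpos t ht)).ne').sub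
      (hasDerivAt_id t)
  have hanti : AntitoneOn (fun t => (√(φ₂ t))⁻¹ - t) (Ici 0) := by
    refine antitoneOn_of_hasDerivWithinAt_nonpos (convex_Ici 0)
      (fun t ht => (hu t ht).continuousAt.continuousWithinAt)
      (fun t ht => (hu t (hint t ht)).hasDerivWithinAt) fun t ht => ?_
    have ht := hint t ht
    have hp := hpos t ht
    have hs := Real.sqrt_pos.2 hp
    have h := hb t ht
    rw [rpow_three_halves (abs_nonneg _), abs_of_pos hp] at h
    have h' := neg_le_of_abs_le h
    rw [sub_nonpos, Real.sq_sqrt hp.le, div_le_one hp, ← neg_div, div_le_iff₀ (by positivity)]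
    linarith
  set c := (√(φ₂ 0))⁻¹ with hc
  have hcpos : 0 < c := inv_pos.2 (Real.sqrt_pos.2 (hpos 0 le_rfl))
  have hlow : ∀ t, 0 ≤ t → ((c + t) ^ 2)⁻¹ ≤ φ₂ t := by
    intro t ht
    have h := hanti (mem_Ici.2 le_rfl) (mem_Ici.2 ht) ht
    simp only [sub_zero] at h
    have h' : (√(φ₂ t))⁻¹ ≤ c + t := by linarith
    have h3 : (c + t)⁻¹ ≤ √(φ₂ t) := inv_le_of_inv_le₀ (Real.sqrt_pos.2 (hpos t ht)) h'
    rw [← inv_pow, ← Real.sq_sqrt (hpos t ht).le]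
    exact pow_le_pow_left₀ (by positivity) h3 2
  have hadd : ∀ t, 0 ≤ t → HasDerivAt (fun t => c + t) 1 t := fun t _ =>
    (hasDerivAt_id t).const_add c
  have hv : ∀ t, 0 ≤ t → HasDerivAt (fun t => φ₁ t + (c + t)⁻¹) (φ₂ t + -1 / (c + t) ^ 2) t :=
    fun t ht => (h₂ t ht).add ((hadd t ht).fun_inv (by positivity))
  have hmono : MonotoneOn (fun t => φ₁ t + (c + t)⁻¹) (Ici 0) := by
    refine monotoneOn_of_hasDerivWithinAt_nonneg (convex_Ici 0)
      (fun t ht => (hv t ht).continuousAt.continuousWithinAt)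
      (fun t ht => (hv t (hint t ht)).hasDerivWithinAt) fun t ht => ?_
    have := hlow t (hint t ht)
    rw [neg_div, one_div]
    linarith
  have hlim : Tendsto (fun s : ℝ => (c + s)⁻¹) atTop (𝓝 0) :=
    tendsto_inv_atTop_zero.comp (tendsto_atTop_add_const_left _ _ tendsto_id)
  have hφ₁ : ∀ t, 0 ≤ t → φ₁ t + (c + t)⁻¹ ≤ 0 := by
    intro t ht
    refine ge_of_tendsto hlim ?_
    filter_upwards [eventually_ge_atTop t] with s hs
    have h := hmono (mem_Ici.2 ht) (mem_Ici.2 (ht.trans hs)) hs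
    have h' := hneg s (ht.trans hs)
    simp only at h
    linarith
  have hw : ∀ t, 0 ≤ t → HasDerivAt (fun t => φ t + Real.log (c + t)) (φ₁ t + 1 / (c + t)) t :=
    fun t ht => (h₁ t ht).add ((hadd t ht).log (by positivity))
  have hanti' : AntitoneOn (fun t => φ t + Real.log (c + t)) (Ici 0) := by
    refine antitoneOn_of_hasDerivWithinAt_nonpos (convex_Ici 0)
      (fun t ht => (hw t ht).continuousAt.continuousWithinAt)
      (fun t ht => (hw t (hint t ht)).hasDerivWithinAt) fun t ht => ?_
    have := hφ₁ t (hint t ht)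
    rwa [one_div]
  refine ⟨c, hcpos, fun t ht => ?_⟩
  have h := hanti' (mem_Ici.2 le_rfl) (mem_Ici.2 ht) ht
  simp only [add_zero] at h
  linarith

/-! ### The Hessian of a self-concordant function -/

section Hessian

variable {E : Type*} [NormedAddCommGroup E] [InnerProductSpace ℝ E] [CompleteSpace E]
  {C : Set E} {f : E → ℝ}

theorem IsSelfConcordant.abs_third_le (hf : IsSelfConcordant C f) {x : E} (hx : x ∈ interior C)
    (h : E) :
    |inner ℝ (fderiv ℝ (hessian f) x h h) h| ≤
      2 * |inner ℝ (hessian f x h) h| ^ (3 / 2 : ℝ) := by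
  have := hf.bound x hx h
  rwa [iteratedDeriv_two_line isOpen_interior hf.contDiffOn hx,
    iteratedDeriv_three_line isOpen_interior hf.contDiffOn hx] at this

theorem IsSelfConcordant.hessian_eq_zero (hf : IsSelfConcordant C f) {x : E}
    (hx : x ∈ interior C) {h : E} (h0 : inner ℝ (hessian f x h) h = 0) : hessian f x h = 0 := by
  have key : ∀ s : ℝ, 0 ≤ inner ℝ (hessian f x (hessian f x h)) (hessian f x h) * (s * s) +
      (2 * inner ℝ (hessian f x h) (hessian f x h)) * s + 0 := by
    intro s
    have h1 := inner_hessian_nonneg isOpen_interior hf.contDiffOn hf.convexOn hx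
      (h + s • hessian f x h)
    have h2 := inner_hessian_symm isOpen_interior hf.contDiffOn hx h (hessian f x h)
    simp only [map_add, map_smul, inner_add_left, inner_add_right, inner_smul_left,
      inner_smul_right, conj_trivial, h0] at h1
    rw [← h2] at h1
    linarith
  have h3 := discrim_le_zero key
  rw [discrim] at h3
  have h4 : inner ℝ (hessian f x h) (hessian f x h) = 0 := by nlinarith
  exact inner_self_eq_zero.1 h4

/-- A self-concordant function whose Hessian degenerates in the direction `h` at one point has a
gradient that is constant on a segment in the direction `h`, by Grönwall's inequality for the
second derivative. Hence injectivity of the gradient forces the Hessian to be positive definite. -/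
theorem IsSelfConcordant.inner_hessian_pos (hf : IsSelfConcordant C f)
    (hinj : InjOn (gradient f) (interior C)) {x : E} (hx : x ∈ interior C) {h : E} (hh : h ≠ 0) :
    0 < inner ℝ (hessian f x h) h := by
  have hU : IsOpen (interior C) := isOpen_interior
  refine (inner_hessian_nonneg hU hf.contDiffOn hf.convexOn hx h).lt_of_ne' fun h0 => hh ?_
  obtain ⟨δ, hδ, hball⟩ := Metric.eventually_nhds_iff_ball.1 (eventually_line_mem_zero hU h hx)
  have hmem : ∀ t ∈ Icc 0 (δ / 2), x + t • h ∈ interior C := fun t ht =>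
    hball t (by rw [Metric.mem_ball, Real.dist_0_eq_abs, abs_of_nonneg ht.1]; linarith [ht.2])
  have hzero := eq_zero_of_abs_deriv_le_rpow
    (fun t ht => hasDerivAt_inner_hessian_line hU hf.contDiffOn (hmem t ht))
    (fun t ht => hf.abs_third_le (hmem t ht) h) (by simpa using h0)
  have hder : ∀ t ∈ Icc 0 (δ / 2), HasDerivAt (fun s : ℝ => gradient f (x + s • h)) 0 t := by
    intro t ht
    have := hasDerivAt_gradient_line hU hf.contDiffOn (hmem t ht)
    rwa [hf.hessian_eq_zero (hmem t ht) (hzero t ht)] at this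
  have hconst := constant_of_has_deriv_right_zero
    (fun t ht => (hder t ht).continuousAt.continuousWithinAt)
    (fun t ht => (hder t (Ico_subset_Icc_self ht)).hasDerivWithinAt) (δ / 2)
    ⟨by positivity, le_rfl⟩
  have := hinj (hmem _ ⟨by positivity, le_rfl⟩) (by simpa using hx) (by simpa using hconst)
  have h5 : (δ / 2) • h = 0 := by simpa using this
  exact (smul_eq_zero.1 h5).resolve_left (by positivity)

end Hessian

/-! ### Cones and their duals -/

section Cone

variable {E : Type*} [NormedAddCommGroup E] [InnerProductSpace ℝ E] {C : Set E}

theorem IsProperCone.convex (hC : IsProperCone C) : Convex ℝ C :=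
  fun x hx y hy a b ha hb _ => hC.add_mem _ (hC.smul_mem a ha x hx) _ (hC.smul_mem b hb y hy)

theorem IsProperCone.add_mem_interior (hC : IsProperCone C) {x y : E} (hx : x ∈ interior C)
    (hy : y ∈ C) : x + y ∈ interior C := by
  refine interior_maximal ?_ (isOpenMap_add_right y _ isOpen_interior) (mem_image_of_mem _ hx)
  rintro _ ⟨z, hz, rfl⟩
  exact hC.add_mem _ (interior_subset hz) _ hy

theorem IsProperCone.smul_mem_interior (hC : IsProperCone C) {x : E} (hx : x ∈ interior C)
    {t : ℝ} (ht : 0 < t) : t • x ∈ interior C := by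
  refine interior_maximal ?_ (isOpenMap_smul₀ ht.ne' _ isOpen_interior) (mem_image_of_mem _ hx)
  rintro _ ⟨z, hz, rfl⟩
  exact hC.smul_mem t ht.le _ (interior_subset hz)

theorem isClosed_dualCone (C : Set E) : IsClosed (dualCone C) := by
  have : dualCone C = ⋂ x ∈ C, {y | 0 ≤ inner ℝ x y} := by
    ext y
    simp [dualCone]
  rw [this]
  exact isClosed_biInter fun x _ => isClosed_le continuous_const (by fun_prop)

theorem add_mem_dualCone {x y : E} (hx : x ∈ dualCone C) (hy : y ∈ dualCone C) :
    x + y ∈ dualCone C := fun z hz => by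
  rw [inner_add_right]
  exact add_nonneg (hx z hz) (hy z hz)

theorem smul_mem_dualCone {x : E} (hx : x ∈ dualCone C) {t : ℝ} (ht : 0 ≤ t) :
    t • x ∈ dualCone C := fun z hz => by
  rw [inner_smul_right]
  exact mul_nonneg ht (hx z hz)

theorem convex_dualCone (C : Set E) : Convex ℝ (dualCone C) :=
  fun _ hx _ hy _ _ ha hb _ => add_mem_dualCone (smul_mem_dualCone hx ha) (smul_mem_dualCone hy hb)

theorem smul_mem_interior_dualCone {x : E} (hx : x ∈ interior (dualCone C)) {t : ℝ} (ht : 0 < t) :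
    t • x ∈ interior (dualCone C) := by
  refine interior_maximal ?_ (isOpenMap_smul₀ ht.ne' _ isOpen_interior) (mem_image_of_mem _ hx)
  rintro _ ⟨z, hz, rfl⟩
  exact smul_mem_dualCone (interior_subset hz) ht.le

theorem exists_mul_norm_le_inner {X : E} (hX : X ∈ interior (dualCone C)) :
    ∃ c > 0, ∀ y ∈ C, c * ‖y‖ ≤ inner ℝ y X := by
  obtain ⟨ε, hε, hball⟩ := Metric.isOpen_iff.1 isOpen_interior X hX
  refine ⟨ε / 2, by positivity, fun y hy => ?_⟩
  rcases eq_or_ne y 0 with rfl | hy0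
  · simp
  have hn : 0 < ‖y‖ := norm_pos_iff.2 hy0
  have hmem : X - (ε / 2 / ‖y‖) • y ∈ Metric.ball X ε := by
    rw [Metric.mem_ball, dist_eq_norm, sub_sub_cancel_left, norm_neg, norm_smul, norm_div,
      norm_norm, div_mul_cancel₀ _ hn.ne', Real.norm_of_nonneg (by positivity)]
    linarith
  have h := interior_subset (hball hmem) y hy
  rw [inner_sub_right, inner_smul_right, real_inner_self_eq_norm_sq] at h
  have : ε / 2 / ‖y‖ * ‖y‖ ^ 2 = ε / 2 * ‖y‖ := by field_simp
  linarith

/-- At a boundary point of the dual cone there is a supporting ray of the cone. -/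
theorem exists_inner_eq_zero_of_notMem_interior [FiniteDimensional ℝ E] (hC : IsProperCone C)
    {X : E} (hX : X ∈ dualCone C) (hX' : X ∉ interior (dualCone C)) :
    ∃ y ∈ C, y ≠ 0 ∧ inner ℝ y X = 0 := by
  by_contra! hcon
  have hcomp : IsCompact (C ∩ Metric.sphere 0 1) := (isCompact_sphere 0 1).inter_left hC.isClosed
  have hpos : ∀ y ∈ C ∩ Metric.sphere 0 1, 0 < inner ℝ y X := fun y hy =>
    (hX y hy.1).lt_of_ne' (hcon y hy.1 fun h => by simp [h] at hy)
  obtain ⟨c, hc, hle⟩ := hcomp.exists_forall_le' (f := fun y => inner ℝ y X)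
    (by fun_prop) hpos
  refine hX' (mem_interior.2 ⟨Metric.ball X c, fun Z hZ y hy => ?_, Metric.isOpen_ball,
    Metric.mem_ball_self hc⟩)
  rcases eq_or_ne y 0 with rfl | hy0
  · simp
  have hn : 0 < ‖y‖ := norm_pos_iff.2 hy0
  have h1 := hle (‖y‖⁻¹ • y) ⟨hC.smul_mem _ (by positivity) _ hy, by
    simp [norm_smul, hn.ne']⟩
  simp only [inner_smul_left, conj_trivial] at h1
  have h2 : c * ‖y‖ ≤ inner ℝ y X := by
    rwa [inv_mul_eq_div, le_div_iff₀ hn] at h1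
  have h3 : -inner ℝ y (Z - X) ≤ ‖y‖ * ‖Z - X‖ := by
    rw [← inner_neg_right, ← norm_neg (Z - X)]
    exact real_inner_le_norm _ _
  rw [Metric.mem_ball, dist_eq_norm] at hZ
  rw [inner_sub_right] at h3
  nlinarith

end Cone

/-! ### Barriers -/

section Barrier

variable {E : Type*} [NormedAddCommGroup E] {C : Set E} {f : E → ℝ}

theorem extendByTop_of_mem {x : E} (hx : x ∈ interior C) : extendByTop C f x = f x := if_pos hx

theorem extendByTop_of_notMem {x : E} (hx : x ∉ interior C) : extendByTop C f x = ⊤ := if_neg hx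

/-- A criterion for barriers in terms of real values only. -/
theorem isBarrier_of_forall (hcont : ContinuousOn f (interior C))
    (hbd : ∀ x ∈ C, x ∉ interior C → ∀ M : ℝ, ∀ᶠ z in 𝓝[C] x, z ∈ interior C → M < f z) :
    IsBarrier C f := by
  intro x hx
  by_cases hxi : x ∈ interior C
  · refine ContinuousAt.continuousWithinAt ?_
    have hev : extendByTop C f =ᶠ[𝓝 x] fun z => (f z : EReal) :=
      (isOpen_interior.eventually_mem hxi).mono fun z hz => extendByTop_of_mem hz
    refine ContinuousAt.congr ?_ hev.symm
    exact continuous_coe_real_ereal.continuousAt.comp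
      (hcont.continuousAt (isOpen_interior.mem_nhds hxi))
  · rw [ContinuousWithinAt, extendByTop_of_notMem hxi, EReal.tendsto_nhds_top_iff_real]
    intro M
    filter_upwards [hbd x hx hxi M] with z hz
    by_cases hzi : z ∈ interior C
    · rw [extendByTop_of_mem hzi]
      exact_mod_cast hz hzi
    · rw [extendByTop_of_notMem hzi]
      exact EReal.coe_lt_top M

theorem IsBarrier.eventually_lt (hf : IsBarrier C f) {x : E} (hx : x ∈ C) {M : ℝ}
    (hM : (M : EReal) < extendByTop C f x) : ∀ᶠ z in 𝓝[C] x, z ∈ interior C → M < f z := by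
  filter_upwards [(hf x hx).eventually (lt_mem_nhds hM)] with z hz hzi
  rw [extendByTop_of_mem hzi] at hz
  exact_mod_cast hz

theorem IsBarrier.eventually_lt_of_notMem (hf : IsBarrier C f) {x : E} (hx : x ∈ C)
    (hx' : x ∉ interior C) (M : ℝ) : ∀ᶠ z in 𝓝[C] x, z ∈ interior C → M < f z :=
  hf.eventually_lt hx (by rw [extendByTop_of_notMem hx']; exact EReal.coe_lt_top M)

theorem IsBarrier.exists_eventually_lt (hf : IsBarrier C f) {x : E} (hx : x ∈ C) :
    ∃ m : ℝ, ∀ᶠ z in 𝓝[C] x, z ∈ interior C → m < f z := by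
  by_cases hxi : x ∈ interior C
  · refine ⟨f x - 1, hf.eventually_lt hx ?_⟩
    rw [extendByTop_of_mem hxi]
    exact_mod_cast sub_one_lt (f x)
  · exact ⟨0, hf.eventually_lt_of_notMem hx hxi 0⟩

end Barrier

/-! ### The gradient of a logarithmically homogeneous self-concordant barrier -/

section LogHom

variable {E : Type*} [NormedAddCommGroup E] [InnerProductSpace ℝ E] [CompleteSpace E]
  {C : Set E} {f : E → ℝ} {θ : ℝ}

theorem IsLogHomSelfConcordantBarrier.inner_gradient_nonpos (hC : IsProperCone C)
    (hf : IsLogHomSelfConcordantBarrier C f θ) {x y : E} (hx : x ∈ interior C) (hy : y ∈ C) :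
    inner ℝ (gradient f x) y ≤ 0 := by
  have hint : ∀ z ∈ interior C, inner ℝ (gradient f x) z ≤ 0 := by
    intro z hz
    -- the supporting hyperplane at `x`, evaluated at `t • z`, grows at most logarithmically
    have hle : ∀ t : ℝ, 0 < t → inner ℝ (gradient f x) z ≤
        (f z - f x + inner ℝ (gradient f x) x) * t⁻¹ - θ * (Real.log t / t) := by
      intro t ht
      have h1 := add_inner_gradient_le isOpen_interior hf.selfConcordant.contDiffOn
        hf.selfConcordant.convexOn hx (hC.smul_mem_interior hz ht)
      rw [hf.logHomogeneous z hz t ht, inner_sub_right, inner_smul_right] at h1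
      have : (f z - f x + inner ℝ (gradient f x) x) * t⁻¹ - θ * (Real.log t / t) =
        (f z - f x + inner ℝ (gradient f x) x - θ * Real.log t) / t := by ring
      rw [this, le_div_iff₀ ht]
      linarith
    have hlog : Tendsto (fun t : ℝ => Real.log t / t) atTop (𝓝 0) := by
      simpa using Real.tendsto_pow_log_div_mul_add_atTop 1 0 1 one_ne_zero
    have hlim := (tendsto_inv_atTop_zero.const_mul
      (f z - f x + inner ℝ (gradient f x) x)).sub (hlog.const_mul θ)
    rw [mul_zero, mul_zero, sub_zero] at hlim
    exact ge_of_tendsto hlim ((eventually_gt_atTop 0).mono hle)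
  have hlim : Tendsto (fun s : ℝ => inner ℝ (gradient f x) (s • x + y)) (𝓝[>] 0)
      (𝓝 (inner ℝ (gradient f x) ((0 : ℝ) • x + y))) :=
    Tendsto.mono_left (Continuous.tendsto (by fun_prop) 0) nhdsWithin_le_nhds
  rw [zero_smul, zero_add] at hlim
  exact le_of_tendsto hlim (eventually_mem_nhdsWithin.mono fun s hs =>
    hint _ (hC.add_mem_interior (hC.smul_mem_interior hx hs) hy))

variable [FiniteDimensional ℝ E]

theorem IsSelfConcordant.exists_equiv_hessian (hf : IsSelfConcordant C f)
    (hinj : InjOn (gradient f) (interior C)) {x : E} (hx : x ∈ interior C) :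
    ∃ A : E ≃L[ℝ] E, (A : E →L[ℝ] E) = hessian f x := by
  have hi : Function.Injective (hessian f x : E →ₗ[ℝ] E) := by
    refine (injective_iff_map_eq_zero _).2 fun h hh => ?_
    by_contra h0
    have := hf.inner_hessian_pos hinj hx h0
    rw [show hessian f x h = 0 from hh, inner_zero_left] at this
    exact this.false
  refine ⟨(LinearEquiv.ofInjectiveEndo _ hi).toContinuousLinearEquiv, ?_⟩
  ext v
  simp

/-- The image of the gradient lies in minus the dual cone, and it is a neighbourhood of each of its
points since the Hessian is invertible. -/
theorem IsLogHomSelfConcordantBarrier.neg_gradient_mem_interior (hC : IsProperCone C)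
    (hf : IsLogHomSelfConcordantBarrier C f θ) (hinj : InjOn (gradient f) (interior C)) {x : E}
    (hx : x ∈ interior C) : -gradient f x ∈ interior (dualCone C) := by
  have hU : IsOpen (interior C) := isOpen_interior
  obtain ⟨A, hA⟩ := hf.selfConcordant.exists_equiv_hessian hinj hx
  have hcd := (contDiffOn_gradient hU hf.selfConcordant.contDiffOn).contDiffAt (hU.mem_nhds hx)
  have hder := hasFDerivAt_gradient hU hf.selfConcordant.contDiffOn hx
  rw [← hA] at hder
  have hmap := (hcd.hasStrictFDerivAt' hder (by norm_num)).map_nhds_eq_of_equiv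
  have himg : gradient f '' interior C ∈ 𝓝 (gradient f x) := by
    rw [← hmap]
    exact image_mem_map (hU.mem_nhds hx)
  have hneg : {z | -z ∈ gradient f '' interior C} ∈ 𝓝 (-gradient f x) :=
    (continuous_neg.tendsto (-gradient f x)) (by rwa [neg_neg])
  refine mem_interior_iff_mem_nhds.2 (mem_of_superset hneg ?_)
  rintro z ⟨w, hw, hwz⟩ y hy
  have h := hf.inner_gradient_nonpos hC hw hy
  rw [hwz, inner_neg_left, real_inner_comm] at h
  linarith

/-- Every `-X` with `X` in the interior of the dual cone is a gradient: the function
`Y ↦ f Y + ⟨X, Y⟩` is coercive on the interior of `C` and tends to `+∞` at the boundary, so that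
it has a minimizer. -/
theorem IsLogHomSelfConcordantBarrier.exists_gradient_eq (hC : IsProperCone C)
    (hf : IsLogHomSelfConcordantBarrier C f θ) {X : E}
    (hX : X ∈ interior (dualCone C)) : ∃ Y ∈ interior C, gradient f Y = -X := by
  have hU : IsOpen (interior C) := isOpen_interior
  have hcd := hf.selfConcordant.contDiffOn
  obtain ⟨Y₀, hY₀⟩ := hC.solid
  -- the supporting hyperplane of `f` at `Y₀`, rescaled until its slope is dominated by `X`
  obtain ⟨s, hs, hsX⟩ : ∃ s : ℝ, 0 < s ∧ X + s • gradient f Y₀ ∈ interior (dualCone C) := by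
    have hcont : Tendsto (fun s : ℝ => X + s • gradient f Y₀) (𝓝[>] 0)
        (𝓝 (X + (0 : ℝ) • gradient f Y₀)) :=
      Tendsto.mono_left (Continuous.tendsto (by fun_prop) 0) nhdsWithin_le_nhds
    rw [zero_smul, add_zero] at hcont
    obtain ⟨s, hs, hs'⟩ := ((hcont.eventually
      (isOpen_interior.mem_nhds hX)).and eventually_mem_nhdsWithin).exists
    exact ⟨s, hs', hs⟩
  obtain ⟨c, hc, hcle⟩ := exists_mul_norm_le_inner hsX
  set A : ℝ := θ * Real.log s + f Y₀ - inner ℝ (gradient f Y₀) Y₀ with hA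
  have hcoer : ∀ Y ∈ interior C, A + c * ‖Y‖ ≤ f Y + inner ℝ X Y := by
    intro Y hY
    have h1 := add_inner_gradient_le hU hcd hf.selfConcordant.convexOn hY₀
      (hC.smul_mem_interior hY hs)
    rw [hf.logHomogeneous Y hY s hs, inner_sub_right, inner_smul_right] at h1
    have h2 := hcle Y (interior_subset hY)
    rw [inner_add_right, inner_smul_right, real_inner_comm, real_inner_comm (gradient f Y₀)] at h2
    linarith
  set φ : E → EReal := fun Y => extendByTop C f Y + (inner ℝ X Y : ℝ) with hφ
  have hφmem : ∀ Y ∈ interior C, φ Y = ((f Y + inner ℝ X Y : ℝ) : EReal) := fun Y hY => by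
    simp only [hφ, extendByTop_of_mem hY, EReal.coe_add]
  have hφcont : ContinuousOn φ C := by
    intro Y hY
    have h1 : ContinuousWithinAt (fun Y => ((inner ℝ X Y : ℝ) : EReal)) C Y :=
      (continuous_coe_real_ereal.comp (by fun_prop)).continuousWithinAt
    have h2 := (EReal.continuousAt_add (p := (extendByTop C f Y, ((inner ℝ X Y : ℝ) : EReal)))
      (.inr (EReal.coe_ne_bot _)) (.inr (EReal.coe_ne_top _))).tendsto
    exact h2.comp ((hf.barrier Y hY).prodMk_nhds h1)
  set R : ℝ := (f Y₀ + inner ℝ X Y₀ - A) / c with hR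
  have hRle : ∀ Y ∈ interior C, f Y + inner ℝ X Y ≤ f Y₀ + inner ℝ X Y₀ → ‖Y‖ ≤ R := by
    intro Y hY hle
    rw [hR, le_div_iff₀ hc]
    linarith [hcoer Y hY]
  have hcomp : IsCompact (C ∩ Metric.closedBall 0 R) :=
    (isCompact_closedBall 0 R).inter_left hC.isClosed
  have hY₀mem : Y₀ ∈ C ∩ Metric.closedBall 0 R :=
    ⟨interior_subset hY₀, by simpa using hRle Y₀ hY₀ le_rfl⟩
  obtain ⟨Z, hZ, hmin⟩ := hcomp.exists_isMinOn ⟨Y₀, hY₀mem⟩ (hφcont.mono inter_subset_left)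
  have hZi : Z ∈ interior C := by
    by_contra hZi
    have h := hmin hY₀mem
    simp only [mem_ofPred_eq] at h
    rw [hφmem Y₀ hY₀, hφ] at h
    simp only [extendByTop_of_notMem hZi, EReal.top_add_coe, top_le_iff] at h
    exact EReal.coe_ne_top _ h
  have hglob : ∀ Y ∈ C ∩ Metric.closedBall 0 R, Y ∈ interior C →
      f Z + inner ℝ X Z ≤ f Y + inner ℝ X Y := by
    intro Y hY hYi
    have h := hmin hY
    simp only [mem_ofPred_eq] at h
    rw [hφmem Y hYi, hφmem Z hZi] at h
    exact_mod_cast h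
  have hlocal : IsLocalMin (fun Y => f Y + inner ℝ X Y) Z := by
    filter_upwards [hU.mem_nhds hZi] with Y hY
    rcases le_or_gt (f Y + inner ℝ X Y) (f Y₀ + inner ℝ X Y₀) with hle | hlt
    · exact hglob Y ⟨interior_subset hY, by simpa using hRle Y hY hle⟩ hY
    · exact (hglob Y₀ hY₀mem hY₀).trans hlt.le
  have hder := hlocal.hasFDerivAt_eq_zero
    ((hasFDerivAt_of_contDiffOn hU hcd hZi).add (innerSL ℝ X).hasFDerivAt)
  refine ⟨Z, hZi, ext_inner_right ℝ fun v => ?_⟩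
  have := DFunLike.congr_fun hder v
  simp only [add_apply, innerSL_apply_apply,
    zero_apply] at this
  rw [inner_gradient_eq_fderiv, inner_neg_left]
  linarith

end LogHom

/-! ### The conjugate barrier -/

section Conjugate

variable {E : Type*} [NormedAddCommGroup E] [InnerProductSpace ℝ E] [CompleteSpace E]
  {C : Set E} {f : E → ℝ} {θ : ℝ}

/-- The point `(∇f)⁻¹ (-X)` of the interior of `C` (for `X` in the interior of the dual cone). -/
noncomputable def dualPoint (C : Set E) (f : E → ℝ) (X : E) : E :=
  Function.invFunOn (gradient f) (interior C) (-X)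

/-- The function `X ↦ f^* (-X)`, with the Fenchel conjugate `f^*` expressed by means of the
inverse of the gradient of `f`. -/
noncomputable def legendreDual (C : Set E) (f : E → ℝ) (X : E) : ℝ :=
  -inner ℝ X (dualPoint C f X) - f (dualPoint C f X)

theorem dualPoint_eq (hinj : InjOn (gradient f) (interior C)) {X Y : E} (hY : Y ∈ interior C)
    (h : gradient f Y = -X) : dualPoint C f X = Y := by
  have hex : ∃ a ∈ interior C, gradient f a = -X := ⟨Y, hY, h⟩
  exact hinj (Function.invFunOn_mem hex) hY ((Function.invFunOn_eq hex).trans h.symm)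

variable [FiniteDimensional ℝ E]

theorem dualPoint_mem (hC : IsProperCone C) (hf : IsLogHomSelfConcordantBarrier C f θ) {X : E}
    (hX : X ∈ interior (dualCone C)) : dualPoint C f X ∈ interior C :=
  Function.invFunOn_mem (hf.exists_gradient_eq hC hX)

theorem gradient_dualPoint (hC : IsProperCone C) (hf : IsLogHomSelfConcordantBarrier C f θ) {X : E}
    (hX : X ∈ interior (dualCone C)) : gradient f (dualPoint C f X) = -X :=
  Function.invFunOn_eq (hf.exists_gradient_eq hC hX)

theorem bijOn_gradient (hC : IsProperCone C) (hf : IsLogHomSelfConcordantBarrier C f θ)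
    (hinj : InjOn (gradient f) (interior C)) :
    BijOn (gradient f) (interior C) {X | -X ∈ interior (dualCone C)} := by
  refine ⟨fun Y hY => hf.neg_gradient_mem_interior hC hinj hY, hinj, fun X hX => ?_⟩
  obtain ⟨Y, hY, h⟩ := hf.exists_gradient_eq hC hX
  exact ⟨Y, hY, by rw [h, neg_neg]⟩

theorem le_legendreDual (hC : IsProperCone C) (hf : IsLogHomSelfConcordantBarrier C f θ) {X Y : E}
    (hX : X ∈ interior (dualCone C)) (hY : Y ∈ interior C) :
    inner ℝ (-X) Y - f Y ≤ legendreDual C f X := by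
  have h := add_inner_gradient_le isOpen_interior hf.selfConcordant.contDiffOn
    hf.selfConcordant.convexOn (dualPoint_mem hC hf hX) hY
  rw [gradient_dualPoint hC hf hX, inner_sub_right] at h
  rw [legendreDual, ← inner_neg_left]
  linarith

theorem isGreatest_legendreDual (hC : IsProperCone C) (hf : IsLogHomSelfConcordantBarrier C f θ)
    {X : E} (hX : X ∈ interior (dualCone C)) :
    IsGreatest ((fun Y => inner ℝ (-X) Y - f Y) '' interior C) (legendreDual C f X) := by
  refine ⟨⟨dualPoint C f X, dualPoint_mem hC hf hX, ?_⟩, ?_⟩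
  · simp [legendreDual]
  · rintro _ ⟨Y, hY, rfl⟩
    exact le_legendreDual hC hf hX hY

/-- By injectivity of the gradient, the global inverse agrees near `-X` with the local inverse
given by the inverse function theorem. -/
theorem contDiffAt_dualPoint (hC : IsProperCone C) (hf : IsLogHomSelfConcordantBarrier C f θ)
    (hinj : InjOn (gradient f) (interior C)) {X : E} (hX : X ∈ interior (dualCone C)) :
    ContDiffAt ℝ 2 (dualPoint C f) X := by
  have hU : IsOpen (interior C) := isOpen_interior
  have hY := dualPoint_mem hC hf hX
  have hgr := gradient_dualPoint hC hf hX
  set Y := dualPoint C f X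
  obtain ⟨A, hA⟩ := hf.selfConcordant.exists_equiv_hessian hinj hY
  have hcd := (contDiffOn_gradient hU hf.selfConcordant.contDiffOn).contDiffAt (hU.mem_nhds hY)
  have hder := hasFDerivAt_gradient hU hf.selfConcordant.contDiffOn hY
  rw [← hA] at hder
  have hstrict := hcd.hasStrictFDerivAt' hder (by norm_num)
  have hloc : ContDiffAt ℝ 2 (hcd.localInverse hder (by norm_num)) (gradient f Y) :=
    hcd.to_localInverse hder (by norm_num)
  have hright := hstrict.eventually_right_inverse
  have htend := hstrict.localInverse_tendsto
  rw [hgr] at hloc hright htend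
  have hev : dualPoint C f =ᶠ[𝓝 X] fun Z => hcd.localInverse hder (by norm_num) (-Z) := by
    have hneg : Tendsto (fun Z : E => -Z) (𝓝 X) (𝓝 (-X)) := continuous_neg.tendsto X
    filter_upwards [hneg.eventually hright,
      hneg.eventually (htend.eventually (hU.mem_nhds hY))] with Z hZ hZU
    exact dualPoint_eq hinj hZU hZ
  exact (ContDiffAt.comp X hloc contDiff_neg.contDiffAt).congr_of_eventuallyEq hev

theorem hasFDerivAt_dualPoint (hC : IsProperCone C) (hf : IsLogHomSelfConcordantBarrier C f θ)
    (hinj : InjOn (gradient f) (interior C)) {X : E} (hX : X ∈ interior (dualCone C)) :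
    HasFDerivAt (dualPoint C f) (fderiv ℝ (dualPoint C f) X) X :=
  ((contDiffAt_dualPoint hC hf hinj hX).differentiableAt (by norm_num)).hasFDerivAt

/-- The derivative of `X ↦ (∇f)⁻¹ (-X)` is minus the inverse of the Hessian of `f`. -/
theorem hessian_fderiv_dualPoint (hC : IsProperCone C) (hf : IsLogHomSelfConcordantBarrier C f θ)
    (hinj : InjOn (gradient f) (interior C)) {X : E} (hX : X ∈ interior (dualCone C)) (h : E) :
    hessian f (dualPoint C f X) (fderiv ℝ (dualPoint C f) X h) = -h := by
  have h1 := (hasFDerivAt_gradient isOpen_interior hf.selfConcordant.contDiffOn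
    (dualPoint_mem hC hf hX)).comp X (hasFDerivAt_dualPoint hC hf hinj hX)
  have h2 : HasFDerivAt (fun Z : E => -Z) (-ContinuousLinearMap.id ℝ E) X :=
    (hasFDerivAt_id X).neg
  have hev : gradient f ∘ dualPoint C f =ᶠ[𝓝 X] fun Z => -Z :=
    (isOpen_interior.eventually_mem hX).mono fun Z hZ => gradient_dualPoint hC hf hZ
  simpa using DFunLike.congr_fun (h1.unique (h2.congr_of_eventuallyEq hev)) h

theorem hasGradientAt_legendreDual (hC : IsProperCone C)
    (hf : IsLogHomSelfConcordantBarrier C f θ) (hinj : InjOn (gradient f) (interior C)) {X : E}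
    (hX : X ∈ interior (dualCone C)) :
    HasGradientAt (legendreDual C f) (-dualPoint C f X) X := by
  have hp := hasFDerivAt_dualPoint hC hf hinj hX
  have h1 := ((hasFDerivAt_id X).inner ℝ hp).neg.sub
    ((hasFDerivAt_of_contDiffOn isOpen_interior hf.selfConcordant.contDiffOn
      (dualPoint_mem hC hf hX)).comp X hp)
  rw [hasGradientAt_iff_hasFDerivAt]
  refine h1.congr_fderiv ?_
  ext v
  have h2 : fderiv ℝ f (dualPoint C f X) (fderiv ℝ (dualPoint C f) X v) =
      -inner ℝ X (fderiv ℝ (dualPoint C f) X v) := by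
    rw [← inner_gradient_eq_fderiv, gradient_dualPoint hC hf hX, inner_neg_left]
  simp [h2, real_inner_comm v, fderivInnerCLM_apply]

/-- The formula for the conjugate only shows it to be as smooth as the inverse of the gradient,
that is `C^2`; one more derivative is gained because its gradient is that inverse, up to sign. -/
theorem contDiffOn_legendreDual (hC : IsProperCone C) (hf : IsLogHomSelfConcordantBarrier C f θ)
    (hinj : InjOn (gradient f) (interior C)) :
    ContDiffOn ℝ 3 (legendreDual C f) (interior (dualCone C)) := by
  rw [show (3 : WithTop ℕ∞) = 2 + 1 by norm_num,
    contDiffOn_succ_iff_fderiv_of_isOpen isOpen_interior]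
  refine ⟨fun X hX => ((hasGradientAt_legendreDual hC hf hinj hX).differentiableAt
    ).differentiableWithinAt, by simp, ?_⟩
  have hcd : ContDiffOn ℝ 2 (fun X => InnerProductSpace.toDual ℝ E (-dualPoint C f X))
      (interior (dualCone C)) :=
    (InnerProductSpace.toDual ℝ E).toContinuousLinearEquiv.contDiff.comp_contDiffOn
      (fun X hX => (contDiffAt_dualPoint hC hf hinj hX).neg.contDiffWithinAt)
  exact hcd.congr fun X hX => (hasGradientAt_legendreDual hC hf hinj hX).hasFDerivAt.fderiv

theorem convexOn_legendreDual (hC : IsProperCone C) (hf : IsLogHomSelfConcordantBarrier C f θ) :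
    ConvexOn ℝ (interior (dualCone C)) (legendreDual C f) := by
  refine ⟨(convex_dualCone C).interior, fun X hX Z hZ a b ha hb hab => ?_⟩
  have hW := (convex_dualCone C).interior hX hZ ha hb hab
  obtain ⟨Y, hY, h⟩ := (isGreatest_legendreDual hC hf hW).1
  rw [← h]
  have h1 := mul_le_mul_of_nonneg_left (le_legendreDual hC hf hX hY) ha
  have h2 := mul_le_mul_of_nonneg_left (le_legendreDual hC hf hZ hY) hb
  simp only [inner_neg_left, inner_add_left, inner_smul_left, conj_trivial, smul_eq_mul] at h1 h2 ⊢
  have h3 : f Y = a * f Y + b * f Y := by rw [← add_mul, hab, one_mul]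
  linarith

theorem hessian_legendreDual (hC : IsProperCone C) (hf : IsLogHomSelfConcordantBarrier C f θ)
    (hinj : InjOn (gradient f) (interior C)) {X : E} (hX : X ∈ interior (dualCone C)) :
    hessian (legendreDual C f) X = -fderiv ℝ (dualPoint C f) X := by
  have hev : gradient (legendreDual C f) =ᶠ[𝓝 X] fun Z => -dualPoint C f Z :=
    (isOpen_interior.eventually_mem hX).mono fun Z hZ =>
      (hasGradientAt_legendreDual hC hf hinj hZ).gradient
  rw [hessian, hev.fderiv_eq, fderiv_fun_neg]

/-- The Legendre transform preserves the self-concordance inequality: if `v` is the image of the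
direction `h` under the derivative of the dual point, then the second and third derivatives of
the conjugate in the direction `h` are those of `f` at the dual point in the direction `v`, up to
sign. -/
theorem abs_third_legendreDual_le (hC : IsProperCone C)
    (hf : IsLogHomSelfConcordantBarrier C f θ) (hinj : InjOn (gradient f) (interior C)) {X : E}
    (hX : X ∈ interior (dualCone C)) (h : E) :
    |inner ℝ (fderiv ℝ (hessian (legendreDual C f)) X h h) h| ≤
      2 * |inner ℝ (hessian (legendreDual C f) X h) h| ^ (3 / 2 : ℝ) := by
  have hU : IsOpen (interior C) := isOpen_interior
  have hY := dualPoint_mem hC hf hX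
  have hcd := hf.selfConcordant.contDiffOn
  have hv := hessian_fderiv_dualPoint hC hf hinj hX h
  have hp := hasFDerivAt_dualPoint hC hf hinj hX
  have hp2 : HasFDerivAt (fderiv ℝ (dualPoint C f)) (fderiv ℝ (fderiv ℝ (dualPoint C f)) X) X :=
    (((contDiffAt_dualPoint hC hf hinj hX).fderiv_right (m := 1) (by norm_num)).differentiableAt
      (by norm_num)).hasFDerivAt
  -- the derivative of the constant function `Z ↦ ∇²f (p Z) (p' Z h) = -h`, with `p` the dual point
  have hsum : fderiv ℝ (hessian f) (dualPoint C f X) (fderiv ℝ (dualPoint C f) X h)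
      (fderiv ℝ (dualPoint C f) X h) +
      hessian f (dualPoint C f X) (fderiv ℝ (fderiv ℝ (dualPoint C f)) X h h) = 0 := by
    have h1 := ((hasFDerivAt_hessian hU hcd hY).comp X hp).clm_apply
      (hp2.clm_apply (hasFDerivAt_const h X))
    have h2 : HasFDerivAt (fun _ : E => -h) (0 : E →L[ℝ] E) X := hasFDerivAt_const _ _
    have hev : (fun Z => (hessian f ∘ dualPoint C f) Z (fderiv ℝ (dualPoint C f) Z h)) =ᶠ[𝓝 X]
        fun _ => -h :=
      (isOpen_interior.eventually_mem hX).mono fun Z hZ => hessian_fderiv_dualPoint hC hf hinj hZ h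
    have h3 := DFunLike.congr_fun (h1.unique (h2.congr_of_eventuallyEq hev)) h
    rw [add_comm]
    simpa using h3
  have hthird : fderiv ℝ (hessian (legendreDual C f)) X =
      -fderiv ℝ (fderiv ℝ (dualPoint C f)) X := by
    have hev : hessian (legendreDual C f) =ᶠ[𝓝 X] fun Z => -fderiv ℝ (dualPoint C f) Z :=
      (isOpen_interior.eventually_mem hX).mono fun Z hZ => hessian_legendreDual hC hf hinj hZ
    rw [hev.fderiv_eq, fderiv_fun_neg]
  have key := hf.selfConcordant.abs_third_le hY (fderiv ℝ (dualPoint C f) X h)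
  rw [hthird, hessian_legendreDual hC hf hinj hX]
  simp only [neg_apply, inner_neg_left, abs_neg]
  set v := fderiv ℝ (dualPoint C f) X h
  set w := fderiv ℝ (fderiv ℝ (dualPoint C f)) X h h
  have e2 : inner ℝ (hessian f (dualPoint C f X) v) v = -inner ℝ v h := by
    rw [hv, inner_neg_left, real_inner_comm]
  have e3 : inner ℝ (fderiv ℝ (hessian f) (dualPoint C f X) v v) v = inner ℝ w h := by
    rw [eq_neg_of_add_eq_zero_left hsum, inner_neg_left,
      inner_hessian_symm hU hcd hY, hv, inner_neg_left, neg_neg, real_inner_comm]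
  rwa [e2, e3, abs_neg] at key

theorem isLogHomogeneous_legendreDual (hC : IsProperCone C)
    (hf : IsLogHomSelfConcordantBarrier C f θ) :
    IsLogHomogeneous (dualCone C) (legendreDual C f) θ := by
  have key : ∀ X ∈ interior (dualCone C), ∀ t : ℝ, 0 < t →
      legendreDual C f (t • X) ≤ legendreDual C f X - θ * Real.log t := by
    intro X hX t ht
    obtain ⟨Y, hY, h⟩ := (isGreatest_legendreDual hC hf (smul_mem_interior_dualCone hX ht)).1
    have h1 := le_legendreDual hC hf hX (hC.smul_mem_interior hY ht)
    rw [hf.logHomogeneous Y hY t ht] at h1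
    rw [← h]
    simp only [inner_neg_left, inner_smul_left, inner_smul_right, conj_trivial] at h1 ⊢
    linarith
  intro X hX t ht
  refine le_antisymm (key X hX t ht) ?_
  have h := key (t • X) (smul_mem_interior_dualCone hX ht) t⁻¹ (inv_pos.2 ht)
  rw [inv_smul_smul₀ ht.ne', Real.log_inv] at h
  linarith

/-- At a boundary point `X` of the dual cone the conjugate of `f` is `+∞`: there is `y ≠ 0` in `C`
with `⟨X, y⟩ = 0`, and self-concordance makes `f` decrease at least logarithmically along the rays
in the direction `y`. -/
theorem exists_lt_inner_sub (hC : IsProperCone C) (hf : IsLogHomSelfConcordantBarrier C f θ)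
    (hinj : InjOn (gradient f) (interior C)) {X : E} (hX : X ∈ dualCone C)
    (hX' : X ∉ interior (dualCone C)) (M : ℝ) : ∃ Y ∈ interior C, M < inner ℝ (-X) Y - f Y := by
  have hU : IsOpen (interior C) := isOpen_interior
  have hcd := hf.selfConcordant.contDiffOn
  obtain ⟨y, hy, hy0, hXy⟩ := exists_inner_eq_zero_of_notMem_interior hC hX hX'
  obtain ⟨Y, hY⟩ := hC.solid
  have hmem : ∀ t : ℝ, 0 ≤ t → Y + t • y ∈ interior C := fun t ht =>
    hC.add_mem_interior hY (hC.smul_mem t ht y hy)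
  obtain ⟨c, hc, hle⟩ := exists_le_sub_log_of_selfConcordant
    (fun t ht => hasDerivAt_comp_line hU hcd (hmem t ht))
    (fun t ht => hasDerivAt_inner_gradient_line hU hcd (hmem t ht))
    (fun t ht => hasDerivAt_inner_hessian_line hU hcd (hmem t ht))
    (fun t ht => hf.selfConcordant.inner_hessian_pos hinj (hmem t ht) hy0)
    (fun t ht => hf.selfConcordant.abs_third_le (hmem t ht) y)
    (fun t ht => hf.inner_gradient_nonpos hC (hmem t ht) hy)
  simp only [zero_smul, add_zero] at hle
  have hlim : Tendsto (fun t => Real.log (c + t)) atTop atTop :=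
    Real.tendsto_log_atTop.comp (tendsto_atTop_add_const_left _ c tendsto_id)
  obtain ⟨t, ht, htM⟩ := ((eventually_ge_atTop (0 : ℝ)).and (hlim.eventually_gt_atTop
    (M + inner ℝ X Y + f Y + Real.log c))).exists
  refine ⟨Y + t • y, hmem t ht, ?_⟩
  have h := hle t ht
  rw [real_inner_comm] at hXy
  rw [inner_neg_left, inner_add_right, inner_smul_right, hXy]
  linarith

theorem isBarrier_legendreDual (hC : IsProperCone C) (hf : IsLogHomSelfConcordantBarrier C f θ)
    (hinj : InjOn (gradient f) (interior C)) : IsBarrier (dualCone C) (legendreDual C f) := by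
  refine isBarrier_of_forall (contDiffOn_legendreDual hC hf hinj).continuousOn
    fun X hX hX' M => ?_
  obtain ⟨Y, hY, hM⟩ := exists_lt_inner_sub hC hf hinj hX hX' M
  have hcont : Tendsto (fun Z => inner ℝ (-Z) Y - f Y) (𝓝[dualCone C] X)
      (𝓝 (inner ℝ (-X) Y - f Y)) :=
    (Continuous.tendsto (by fun_prop) X).mono_left nhdsWithin_le_nhds
  filter_upwards [hcont.eventually (lt_mem_nhds hM)] with Z hZ hZi
  exact hZ.trans_le (le_legendreDual hC hf hZi hY)

theorem isLogHomSelfConcordantBarrier_legendreDual (hC : IsProperCone C)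
    (hf : IsLogHomSelfConcordantBarrier C f θ) (hinj : InjOn (gradient f) (interior C)) :
    IsLogHomSelfConcordantBarrier (dualCone C) (legendreDual C f) θ where
  barrier := isBarrier_legendreDual hC hf hinj
  selfConcordant :=
    { convexOn := convexOn_legendreDual hC hf
      contDiffOn := contDiffOn_legendreDual hC hf hinj
      bound := fun X hX h => by
        rw [iteratedDeriv_two_line isOpen_interior (contDiffOn_legendreDual hC hf hinj) hX,
          iteratedDeriv_three_line isOpen_interior (contDiffOn_legendreDual hC hf hinj) hX]
        exact abs_third_legendreDual_le hC hf hinj hX h }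
  logHomogeneous := isLogHomogeneous_legendreDual hC hf

end Conjugate

/-! ### The bidual of a convex cone -/

section Bidual

variable {E : Type*} [NormedAddCommGroup E] [InnerProductSpace ℝ E] [CompleteSpace E] {P : Set E}

/-- The bipolar theorem for convex cones. -/
theorem dualCone_dualCone_eq_closure (h0 : (0 : E) ∈ P) (hconv : Convex ℝ P)
    (hsmul : ∀ t : ℝ, 0 ≤ t → ∀ x ∈ P, t • x ∈ P) : dualCone (dualCone P) = closure P := by
  refine Subset.antisymm (fun x hx => ?_) (closure_minimal (fun x hx y hy => ?_)
    (isClosed_dualCone _))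
  · by_contra hxP
    obtain ⟨l, u, hlu, hux⟩ := geometric_hahn_banach_closed_point hconv.closure isClosed_closure hxP
    have hu : 0 < u := by simpa using hlu 0 (subset_closure h0)
    have hl : ∀ a ∈ P, l a ≤ 0 := by
      intro a ha
      by_contra! hpos
      have h := hlu _ (subset_closure (hsmul (u / l a) (by positivity) a ha))
      rw [map_smul, smul_eq_mul, div_mul_cancel₀ _ hpos.ne'] at h
      exact h.false
    have hmem : -(InnerProductSpace.toDual ℝ E).symm l ∈ dualCone P := fun a ha => by
      rw [inner_neg_right, real_inner_comm, InnerProductSpace.toDual_symm_apply]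
      linarith [hl a ha]
    have h := hx _ hmem
    rw [inner_neg_left, InnerProductSpace.toDual_symm_apply] at h
    linarith
  · rw [real_inner_comm]
    exact hy x hx

/-- Passing from a convex cone to its bidual does not change the interior, provided that the bidual
is solid: the cone then spans the whole space. -/
theorem interior_dualCone_dualCone [FiniteDimensional ℝ E] (h0 : (0 : E) ∈ P) (hconv : Convex ℝ P)
    (hsmul : ∀ t : ℝ, 0 ≤ t → ∀ x ∈ P, t • x ∈ P)
    (hne : (interior (dualCone (dualCone P))).Nonempty) :
    interior (dualCone (dualCone P)) = interior P := by
  rw [dualCone_dualCone_eq_closure h0 hconv hsmul] at hne ⊢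
  refine hconv.interior_closure_eq_interior_of_nonempty_interior ?_
  rw [hconv.interior_nonempty_iff_affineSpan_eq_top, eq_top_iff,
    ← (hconv.closure).interior_nonempty_iff_affineSpan_eq_top.1 hne]
  exact affineSpan_le.2 (closure_minimal (subset_affineSpan ℝ P)
    (AffineSubspace.closed_of_finiteDimensional _))

end Bidual

theorem IsLogHomSelfConcordantBarrier.of_subset {E : Type*} [NormedAddCommGroup E]
    [InnerProductSpace ℝ E] {P Q : Set E} {F : E → ℝ} {θ : ℝ}
    (hF : IsLogHomSelfConcordantBarrier Q F θ) (hPQ : P ⊆ Q) (hint : interior P = interior Q) :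
    IsLogHomSelfConcordantBarrier P F θ where
  barrier := by
    have : extendByTop P F = extendByTop Q F := by
      funext x
      by_cases hx : x ∈ interior Q
      · rw [extendByTop_of_mem hx, extendByTop_of_mem (hint ▸ hx)]
      · rw [extendByTop_of_notMem hx, extendByTop_of_notMem (hint ▸ hx)]
    rw [IsBarrier, this]
    exact ContinuousOn.mono hF.barrier hPQ
  selfConcordant :=
    { convexOn := hint ▸ hF.selfConcordant.convexOn
      contDiffOn := hint ▸ hF.selfConcordant.contDiffOn
      bound := hint ▸ hF.selfConcordant.bound }
  logHomogeneous := fun x hx => hF.logHomogeneous x (hint ▸ hx)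

/-! ### Sums of barriers composed with surjective linear maps -/

section Sum

theorem sum_rpow_le_rpow_sum {ι : Type*} (J : Finset ι) {b : ι → ℝ} (hb : ∀ i ∈ J, 0 ≤ b i)
    {p : ℝ} (hp : 1 ≤ p) : ∑ i ∈ J, b i ^ p ≤ (∑ i ∈ J, b i) ^ p := by
  classical
  induction J using Finset.induction_on with
  | empty => simp [Real.zero_rpow (zero_lt_one.trans_le hp).ne']
  | insert i J hi ih =>
    rw [Finset.sum_insert hi, Finset.sum_insert hi]
    have h1 := ih fun j hj => hb j (Finset.mem_insert_of_mem hj)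
    have h2 := Real.add_rpow_le_rpow_add (hb i (Finset.mem_insert_self i J))
      (Finset.sum_nonneg fun j hj => hb j (Finset.mem_insert_of_mem hj)) hp
    linarith

variable {ι E F : Type*} [NormedAddCommGroup E] [InnerProductSpace ℝ E] [FiniteDimensional ℝ E]
  [NormedAddCommGroup F] [InnerProductSpace ℝ F] [FiniteDimensional ℝ F]
  {J : Finset ι} {A : ι → E →ₗ[ℝ] F} {C : Set F} {D : Set E} {g : F → ℝ} {θ : ℝ}

/-- Surjective linear maps are open, so the interior of an intersection of preimages is the
intersection of the preimages of the interior. -/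
theorem mem_interior_iff_forall_map_mem (hA : ∀ i ∈ J, Function.Surjective (A i))
    (hD : ∀ x, x ∈ D ↔ ∀ i ∈ J, A i x ∈ C) (x : E) :
    x ∈ interior D ↔ ∀ i ∈ J, A i x ∈ interior C := by
  constructor
  · intro hx i hi
    refine interior_maximal ?_
      ((A i).isOpenMap_of_finiteDimensional (hA i hi) _ isOpen_interior) (mem_image_of_mem _ hx)
    rintro _ ⟨z, hz, rfl⟩
    exact (hD z).1 (interior_subset hz) i hi
  · intro hx
    refine mem_interior_iff_mem_nhds.2 ?_
    have : ∀ᶠ z in 𝓝 x, ∀ i ∈ J, A i z ∈ interior C :=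
      (Finset.eventually_all J).2 fun i hi =>
        (A i).continuous_of_finiteDimensional.continuousAt.eventually
          (isOpen_interior.mem_nhds (hx i hi))
    filter_upwards [this] with z hz
    exact (hD z).2 fun i hi => interior_subset (hz i hi)

/-- The degrees of homogeneity of the summands add up. The self-concordance inequality passes to
the sum because the second derivatives `bᵢ` of the summands are nonnegative, so that
`∑ bᵢ ^ (3 / 2) ≤ (∑ bᵢ) ^ (3 / 2)`. -/
theorem IsLogHomSelfConcordantBarrier.sum_comp [CompleteSpace F] (hC : Convex ℝ C)
    (hA : ∀ i ∈ J, Function.Surjective (A i)) (hD : ∀ x, x ∈ D ↔ ∀ i ∈ J, A i x ∈ C)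
    (hg : IsLogHomSelfConcordantBarrier C g θ) :
    IsLogHomSelfConcordantBarrier D (fun x => ∑ i ∈ J, g (A i x)) (θ * J.card) := by
  have hint := mem_interior_iff_forall_map_mem hA hD
  have hcA : ∀ i, Continuous (A i) := fun i => (A i).continuous_of_finiteDimensional
  have hDconv : Convex ℝ D := by
    intro x hx y hy a b ha hb hab
    refine (hD _).2 fun i hi => ?_
    rw [map_add, map_smul, map_smul]
    exact hC ((hD x).1 hx i hi) ((hD y).1 hy i hi) ha hb hab
  have hU : IsOpen (interior C) := isOpen_interior
  have hcd := hg.selfConcordant.contDiffOn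
  have hcdD : ContDiffOn ℝ 3 (fun x => ∑ i ∈ J, g (A i x)) (interior D) := by
    refine ContDiffOn.sum fun i hi => ?_
    exact hcd.comp (A i).toContinuousLinearMap.contDiff.contDiffOn fun x hx => (hint x).1 hx i hi
  refine ⟨?_, ⟨⟨hDconv.interior, ?_⟩, hcdD, ?_⟩, ?_⟩
  · refine isBarrier_of_forall hcdD.continuousOn fun x hx hx' M => ?_
    -- one summand tends to `+∞` and the others are bounded below
    rw [hint] at hx'
    push Not at hx'
    obtain ⟨j, hj, hjx⟩ := hx'
    have htend : ∀ i ∈ J, Tendsto (A i) (𝓝[D] x) (𝓝[C] (A i x)) := fun i hi =>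
      (hcA i).continuousWithinAt.tendsto_nhdsWithin fun z hz => (hD z).1 hz i hi
    have hex : ∀ i, ∃ m : ℝ, i ∈ J → ∀ᶠ z in 𝓝[C] (A i x), z ∈ interior C → m < g z := by
      intro i
      by_cases hi : i ∈ J
      · obtain ⟨m, hm⟩ := hg.barrier.exists_eventually_lt ((hD x).1 hx i hi)
        exact ⟨m, fun _ => hm⟩
      · exact ⟨0, fun h => absurd h hi⟩
    choose m hm using hex
    have h1 : ∀ᶠ z in 𝓝[D] x, ∀ i ∈ J, A i z ∈ interior C → m i < g (A i z) :=
      (Finset.eventually_all J).2 fun i hi => (htend i hi).eventually (hm i hi)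
    have h2 := (htend j hj).eventually (hg.barrier.eventually_lt_of_notMem ((hD x).1 hx j hj) hjx
      (M - ∑ i ∈ J, m i + m j))
    filter_upwards [h1, h2] with z hz1 hz2 hz
    rw [hint] at hz
    have h3 : g (A j z) - m j ≤ ∑ i ∈ J, (g (A i z) - m i) :=
      Finset.single_le_sum (f := fun i => g (A i z) - m i)
        (fun i hi => sub_nonneg.2 (hz1 i hi (hz i hi)).le) hj
    rw [Finset.sum_sub_distrib] at h3
    linarith [hz2 (hz j hj)]
  · intro x hx y hy a b ha hb hab
    rw [smul_eq_mul, smul_eq_mul, Finset.mul_sum, Finset.mul_sum, ← Finset.sum_add_distrib]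
    refine Finset.sum_le_sum fun i hi => ?_
    rw [map_add, map_smul, map_smul]
    exact hg.selfConcordant.convexOn.2 ((hint x).1 hx i hi) ((hint y).1 hy i hi) ha hb hab
  · intro x hx h
    simp only [map_add, map_smul]
    have hx := (hint x).1 hx
    have hev : ∀ᶠ t in 𝓝 (0 : ℝ), ∀ i ∈ J, A i x + t • A i h ∈ interior C :=
      (Finset.eventually_all J).2 fun i hi => eventually_line_mem_zero hU _ (hx i hi)
    have h0 := hev.mono fun t ht =>
      HasDerivAt.fun_sum (x := t) fun i hi =>
        hasDerivAt_comp_line hU hcd (x := A i x) (h := A i h) (ht i hi)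
    have h1 := hev.mono fun t ht =>
      HasDerivAt.fun_sum (x := t) fun i hi =>
        hasDerivAt_inner_gradient_line hU hcd (x := A i x) (h := A i h) (ht i hi)
    have h2 := HasDerivAt.fun_sum (x := (0 : ℝ)) fun i hi =>
      hasDerivAt_inner_hessian_line hU hcd (x := A i x) (h := A i h) (hev.self_of_nhds i hi)
    rw [iteratedDeriv_two_eq_of_hasDerivAt h0 h1.self_of_nhds,
      iteratedDeriv_three_eq_of_hasDerivAt h0 h1 h2]
    simp only [zero_smul, add_zero]
    have hnn : ∀ i ∈ J, 0 ≤ inner ℝ (hessian g (A i x) (A i h)) (A i h) := fun i hi =>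
      inner_hessian_nonneg hU hcd hg.selfConcordant.convexOn (hx i hi) _
    rw [abs_of_nonneg (Finset.sum_nonneg hnn)]
    refine (Finset.abs_sum_le_sum_abs _ _).trans (le_trans ?_ (mul_le_mul_of_nonneg_left
      (sum_rpow_le_rpow_sum J hnn (p := 3 / 2) (by norm_num)) zero_le_two))
    rw [Finset.mul_sum]
    refine Finset.sum_le_sum fun i hi => ?_
    have := hg.selfConcordant.abs_third_le (hx i hi) (A i h)
    rwa [abs_of_nonneg (hnn i hi)] at this
  · intro x hx t ht
    have : ∀ i ∈ J, g (A i (t • x)) = g (A i x) - θ * Real.log t := fun i hi => by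
      rw [map_smul, hg.logHomogeneous _ ((hint x).1 hx i hi) t ht]
    change ∑ i ∈ J, g (A i (t • x)) = ∑ i ∈ J, g (A i x) - _
    rw [Finset.sum_congr rfl this, Finset.sum_sub_distrib, Finset.sum_const, nsmul_eq_mul]
    ring

end Sum

/-! ### Cones of higher order -/

open SymMat

/-- Lifting and truncation are adjoint to each other. -/
theorem inner_lift {d k : ℕ} (i : Fin k ↪o Fin d) (X : SymMat k) (Y : SymMat d) :
    inner ℝ (lift i X) Y = inner ℝ X (trn i Y) := by
  have h : (liftMat i (toMat X) * toMat Y).trace =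
      ∑ p, ∑ q, toMat X p q * toMat Y (i q) (i p) := by
    simp only [Matrix.trace, Matrix.diag, Matrix.mul_apply, liftMat, Matrix.of_apply,
      Finset.sum_mul, ite_mul, zero_mul, ite_and]
    calc _ = ∑ a, ∑ p, ∑ q, ∑ b, if i p = a then if i q = b then toMat X p q * toMat Y b a
          else 0 else 0 := by
          refine Finset.sum_congr rfl fun a _ => ?_
          rw [Finset.sum_comm]
          refine Finset.sum_congr rfl fun p _ => ?_
          rw [Finset.sum_comm]
      _ = _ := by
          rw [Finset.sum_comm]
          refine Finset.sum_congr rfl fun p _ => ?_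
          rw [Finset.sum_comm]
          refine Finset.sum_congr rfl fun q _ => ?_
          rw [Finset.sum_comm]
          simp
  rw [inner_def, inner_def]
  refine h.trans ?_
  simp [Matrix.trace, Matrix.mul_apply, trn]

variable {d k : ℕ} {C : Set (SymMat k)} {J : Finset (Fin k ↪o Fin d)}

theorem mem_dualCone_orderCone (h0 : (0 : SymMat k) ∈ C) (Y : SymMat d) :
    Y ∈ dualCone (orderCone C J) ↔ ∀ i ∈ J, trn i Y ∈ dualCone C := by
  classical
  constructor
  · intro hY i hi X hX
    rw [← inner_lift]
    refine hY _ ⟨Pi.single i X, fun j _ => ?_, ?_⟩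
    · rcases eq_or_ne j i with rfl | hji
      · simpa using hX
      · simpa [hji] using h0
    · rw [Finset.sum_eq_single_of_mem i hi fun j _ hji => by simp [hji]]
      simp
  · rintro hY _ ⟨N, hN, rfl⟩
    rw [sum_inner]
    refine Finset.sum_nonneg fun i hi => ?_
    rw [inner_lift]
    exact hY i hi _ (hN i hi)

theorem zero_mem_orderCone (h0 : (0 : SymMat k) ∈ C) : (0 : SymMat d) ∈ orderCone C J :=
  ⟨0, fun _ _ => h0, by simp⟩

theorem smul_mem_orderCone (hC : IsProperCone C) (t : ℝ) (ht : 0 ≤ t) (X : SymMat d)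
    (hX : X ∈ orderCone C J) : t • X ∈ orderCone C J := by
  obtain ⟨N, hN, rfl⟩ := hX
  exact ⟨t • N, fun i hi => hC.smul_mem t ht _ (hN i hi), by simp [Finset.smul_sum]⟩

theorem convex_orderCone (hC : IsProperCone C) : Convex ℝ (orderCone (d := d) C J) := by
  rintro _ ⟨N, hN, rfl⟩ _ ⟨N', hN', rfl⟩ a b ha hb hab
  exact ⟨a • N + b • N', fun i hi => hC.convex (hN i hi) (hN' i hi) ha hb hab,
    by simp [Finset.smul_sum, Finset.sum_add_distrib]⟩

end HigherOrderCone

theorem mainTheorem12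
    (k₀ : ℕ) (hk₀ : 1 ≤ k₀)
    (K : (k : ℕ) → Set (HigherOrderCone.SymMat k))
    (I : (d k : ℕ) → Finset (Fin k ↪o Fin d))
    (hK : HigherOrderCone.EmbeddingProperty k₀ K I)
    (d k : ℕ) (hk : k₀ ≤ k) (hkd : k ≤ d)
    (θ : ℝ) (g : HigherOrderCone.SymMat k → ℝ)
    (hg : HigherOrderCone.IsLogHomSelfConcordantBarrier
      (HigherOrderCone.dualCone (K k)) g θ) :
    let P : Set (HigherOrderCone.SymMat d) := HigherOrderCone.orderCone (K k) (I d k)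
    let D : Set (HigherOrderCone.SymMat d) := HigherOrderCone.dualCone P
    let f : HigherOrderCone.SymMat d → ℝ := HigherOrderCone.sumBarrier (I d k) g
    let F : HigherOrderCone.SymMat d → ℝ := HigherOrderCone.conjBarrier D f
    HigherOrderCone.IsLogHomSelfConcordantBarrier D f (θ * (I d k).card) ∧
    (HigherOrderCone.IsProperCone D → Set.InjOn (gradient f) (interior D) →
      -- `∇f` maps `int D` bijectively onto `-int P`, so that `(∇f)⁻¹ (-X)` makes sense on `int P`
      Set.BijOn (gradient f) (interior D) {X | -X ∈ interior P} ∧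
      -- `F (X) = f^* (-X)`, with `f^*` the Fenchel conjugate of `f`
      (∀ X ∈ interior P,
        IsLUB ((fun Y => inner ℝ (-X) Y - f Y) '' interior D) (F X)) ∧
      HigherOrderCone.IsLogHomSelfConcordantBarrier P F (θ * (I d k).card)) := by
  intro P D f F
  have hC : HigherOrderCone.IsProperCone (K k) := hK.proper k hk
  have hf : HigherOrderCone.IsLogHomSelfConcordantBarrier D f (θ * (I d k).card) :=
    hg.sum_comp (HigherOrderCone.convex_dualCone _)
      (fun i _ X => ⟨HigherOrderCone.SymMat.lift i X, HigherOrderCone.SymMat.trn_lift i X⟩)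
      (HigherOrderCone.mem_dualCone_orderCone hC.zero_mem)
  refine ⟨hf, fun hD hinj => ?_⟩
  have h0 : (0 : HigherOrderCone.SymMat d) ∈ P :=
    HigherOrderCone.zero_mem_orderCone hC.zero_mem
  have hconv : Convex ℝ P := HigherOrderCone.convex_orderCone hC
  have hsmul : ∀ t : ℝ, 0 ≤ t → ∀ x ∈ P, t • x ∈ P := HigherOrderCone.smul_mem_orderCone hC
  have hint : interior (HigherOrderCone.dualCone D) = interior P := by
    obtain ⟨Y, hY⟩ := hD.solid
    exact HigherOrderCone.interior_dualCone_dualCone h0 hconv hsmul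
      ⟨_, hf.neg_gradient_mem_interior hD hinj hY⟩
  have hsub : P ⊆ HigherOrderCone.dualCone D :=
    subset_closure.trans (HigherOrderCone.dualCone_dualCone_eq_closure h0 hconv hsmul).ge
  -- `F` is definitionally equal to `legendreDual D f`
  refine ⟨hint ▸ HigherOrderCone.bijOn_gradient hD hf hinj, fun X hX => ?_, ?_⟩
  · exact (HigherOrderCone.isGreatest_legendreDual hD hf (hint ▸ hX)).isLUB
  · exact (HigherOrderCone.isLogHomSelfConcordantBarrier_legendreDual hD hf hinj).of_subset hsub
      hint.symm
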